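/- Let $A$ be a $\sigma$-unital non-elementary simple $C^*$-algebra (simple: $A\neq 0$ has no non-trivial closed two-sided ideals; non-elementary: $A$ is not isomorphic to the algebra of compact operators on a Hilbert space). Notation. $\mathrm{Ped}(A)$ is the Pedersen ideal (the smallest dense two-sided ideal). $\widetilde{\mathrm T}(A)$ is the cone of densely defined lower semicontinuous positive traces on $A$, with the topology of pointwise convergence on $\mathrm{Ped}(A)$; $\mathrm T(A)\subset\widetilde{\mathrm T}(A)$ is the set of tracial states and $\overline{\mathrm T(A)}^{\mathrm w}$ its closure in $\widetilde{\mathrm T}(A)$. For $0<\varepsilon<1$ let $f_\varepsilon:[0,\infty)\to[0,1]$ be $0$ on $[0,\varepsilon/2]$, $1$ on $[\varepsilon,\infty)$ and affine on $[\varepsilon/2,\varepsilon]$, and for $a\in A_+$ put $\mathrm d_\tau(a)=\lim_{\varepsilon\to0}\tau(f_\varepsilon(a))\in[0,\infty]$. Every $\tau\in\widetilde{\mathrm T}(A)$ is extended to $(A\otimes\mathcal K)_+$ by $\tau(a\otimes b)=\tau(a)\mathrm{Tr}(b)$, where $\mathcal K$ is the algebra of compact operators on $\ell^2$, and $\mathrm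 d_\tau$ is defined on $(A\otimes\mathcal K)_+$ by the same formula. Write $a\lesssim b$ if $x_n^*bx_n\to a$ in norm for some sequence $(x_n)$. An element $a\in A_+$ is strictly positive if $aAa$ is dense in $A$. $A$ has continuous scale if it has an increasing approximate unit $(e_n)$ with $e_{n+1}e_n=e_ne_{n+1}=e_n$ for all $n$ such that for every $b\in A_+\setminus\{0\}$ there is $N\ge1$ with $e_m-e_n\lesssim b$ for all $m>n\ge N$. $A$ has strict comparison for positive elements using traces if for all $a,b\in(A\otimes\mathcal K)_+$ with $b\ne0$ and $\mathrm d_\tau(a)<\mathrm d_\tau(b)<+\infty$ for every $\tau\in\widetilde{\mathrm T}(A)\setminus\{0\}$ one has $a\lesssim b$. Theorem. If $A$ has continuous scale, then (1) $\mathrm T(A)$ is compact; (2) $\mathrm d_\tau(a)$ is continuous in $\tau\in\widetilde{\mathrm T}(A)$ for every strictly positive element $a$ of $A$; (3) $\mathrm d_\tau(a)$ is continuous in $\tau\in\overline{\mathrm T(A)}^{\mathrm w}$ for every strictly positive element $a$ of $A$. Conversely, if $A$ has strict comparison for positive elements using traces and is algebraically simple (no non-trivial two-sided ideals, closed or not),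 then (1), (2) and (3) are equivalent to each other and to each of the following conditions: (4) $A$ has continuous scale; (5) $\mathrm d_\tau(a)$ is continuous in $\tau\in\overline{\mathrm T(A)}^{\mathrm w}$ for some strictly positive element $a$ of $A$; (6) $\mathrm d_\tau(a)$ is continuous in $\tau\in\widetilde{\mathrm T}(A)$ for some strictly positive element $a$ of $A$. -/

import Mathlib

open Filter Topology Set
open scoped ENNReal NNReal ComplexOrder

set_option linter.unusedSectionVars false

noncomputable section

namespace ConScale

universe u

/-! ### The algebra of finitely supported infinite matrices over `A` -/

section Stabilization

variable (A : Type u) [NonUnitalCStarAlgebra A] [PartialOrder A] [StarOrderedRing A]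

/-- Infinite matrices over `A` with only finitely many nonzero entries, as a vector space. -/
def finMat : Submodule ℂ (ℕ → ℕ → A) where
  carrier := {x | ∃ N, ∀ i j, N ≤ i ∨ N ≤ j → x i j = 0}
  zero_mem' := ⟨0, fun _ _ _ => rfl⟩
  add_mem' := by
    rintro x y ⟨N, hN⟩ ⟨M, hM⟩
    refine ⟨max N M, fun i j h => ?_⟩
    have h1 : N ≤ i ∨ N ≤ j := by omega
    have h2 : M ≤ i ∨ M ≤ j := by omega
    simp [hN i j h1, hM i j h2]
  smul_mem' := by
    rintro c x ⟨N, hN⟩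
    exact ⟨N, fun i j h => by simp [hN i j h]⟩

/-- The `*`-algebra `M_∞(A) = ⋃ₙ Mₙ(A)`. -/
def FinMat : Type u := ↥(finMat A)

instance : AddCommGroup (FinMat A) := inferInstanceAs (AddCommGroup ↥(finMat A))
instance : Module ℂ (FinMat A) := inferInstanceAs (Module ℂ ↥(finMat A))

variable {A}

namespace FinMat

/-- The `(i, j)` entry. -/
def entry (x : FinMat A) (i j : ℕ) : A := x.1 i j

/-- The upper left `n × n` corner. -/
def corner (n : ℕ) (x : FinMat A) : CStarMatrix (Fin n) (Fin n) A :=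
  CStarMatrix.ofMatrix fun i j => x.entry i j

lemma corner_apply (n : ℕ) (x : FinMat A) (i j : Fin n) : corner n x i j = x.entry i j := rfl

/-- `N` bounds the support of `x`. -/
def Bound (x : FinMat A) (N : ℕ) : Prop := ∀ i j, N ≤ i ∨ N ≤ j → x.entry i j = 0

lemma exists_bound (x : FinMat A) : ∃ N, x.Bound N := x.2

lemma Bound.mono {x : FinMat A} {N M : ℕ} (h : x.Bound N) (hNM : N ≤ M) : x.Bound M :=
  fun i j hij => h i j (by omega)

lemma eventually_bound (x : FinMat A) : ∀ᶠ n in atTop, x.Bound n := by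
  obtain ⟨N, hN⟩ := x.exists_bound
  filter_upwards [eventually_ge_atTop N] with n hn using hN.mono hn

@[ext] lemma ext {x y : FinMat A} (h : ∀ i j, x.entry i j = y.entry i j) : x = y :=
  Subtype.ext (funext fun i => funext fun j => h i j)

@[simp] lemma entry_add (x y : FinMat A) (i j : ℕ) :
    (x + y).entry i j = x.entry i j + y.entry i j := rfl
@[simp] lemma entry_smul (c : ℂ) (x : FinMat A) (i j : ℕ) :
    (c • x).entry i j = c • x.entry i j := rfl
@[simp] lemma entry_zero (i j : ℕ) : (0 : FinMat A).entry i j = 0 := rfl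

@[simp] lemma corner_add (n : ℕ) (x y : FinMat A) :
    corner n (x + y) = corner n x + corner n y := rfl
@[simp] lemma corner_smul (n : ℕ) (c : ℂ) (x : FinMat A) :
    corner n (c • x) = c • corner n x := rfl
@[simp] lemma corner_zero (n : ℕ) : corner n (0 : FinMat A) = 0 := rfl

lemma ext_of_corner {x y : FinMat A} (h : ∀ᶠ n in atTop, corner n x = corner n y) : x = y := by
  ext i j
  obtain ⟨n, hn, hi, hj⟩ :=
    (h.and ((eventually_gt_atTop i).and (eventually_gt_atTop j))).exists
  exact congrFun (congrFun hn ⟨i, hi⟩) ⟨j, hj⟩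

/-- Matrix multiplication: `(x y)ᵢⱼ = ∑ₖ xᵢₖ yₖⱼ`, a sum with finitely many nonzero terms. -/
instance : Mul (FinMat A) where
  mul x y := ⟨fun i j => ∑ᶠ k, x.entry i k * y.entry k j, by
    obtain ⟨N, hx⟩ := x.exists_bound
    obtain ⟨M, hy⟩ := y.exists_bound
    refine ⟨max N M, fun i j h => ?_⟩
    have : (fun k => x.entry i k * y.entry k j) = fun _ => 0 := by
      funext k
      rcases h with h | h
      · rw [hx i k (by omega), zero_mul]
      · rw [hy k j (by omega), mul_zero]
    change (∑ᶠ k, x.entry i k * y.entry k j) = 0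
    rw [this, finsum_zero]⟩

/-- The adjoint: `(x*)ᵢⱼ = (xⱼᵢ)*`. -/
instance : Star (FinMat A) where
  star x := ⟨fun i j => star (x.entry j i), by
    obtain ⟨N, hx⟩ := x.exists_bound
    exact ⟨N, fun i j h => by change star (x.entry j i) = 0; rw [hx j i h.symm, star_zero]⟩⟩

lemma entry_mul (x y : FinMat A) (i j : ℕ) :
    (x * y).entry i j = ∑ᶠ k, x.entry i k * y.entry k j := rfl

@[simp] lemma entry_star (x : FinMat A) (i j : ℕ) :
    (star x).entry i j = star (x.entry j i) := rfl

@[simp] lemma corner_star (n : ℕ) (x : FinMat A) : corner n (star x) = star (corner n x) := rfl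

lemma corner_mul {x : FinMat A} {n : ℕ} (hx : x.Bound n) (y : FinMat A) :
    corner n (x * y) = corner n x * corner n y := by
  ext i j
  rw [CStarMatrix.mul_apply, corner_apply, entry_mul,
    finsum_eq_sum_of_support_subset (s := Finset.range n), Finset.sum_range]
  · rfl
  · intro k hk
    simp only [Finset.coe_range, Set.mem_Iio]
    by_contra h
    exact hk (by simp [hx i k (Or.inr (not_lt.mp h))])

lemma eventually_corner_mul (x y : FinMat A) :
    ∀ᶠ n in atTop, corner n (x * y) = corner n x * corner n y :=
  x.eventually_bound.mono fun _ h => corner_mul h y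

instance : NonUnitalRing (FinMat A) where
  __ := (inferInstance : AddCommGroup (FinMat A))
  mul := (· * ·)
  left_distrib x y z := ext_of_corner <| by
    filter_upwards [eventually_corner_mul x (y + z), eventually_corner_mul x y,
      eventually_corner_mul x z] with n h1 h2 h3
    rw [corner_add, h1, h2, h3, corner_add, mul_add]
  right_distrib x y z := ext_of_corner <| by
    filter_upwards [eventually_corner_mul (x + y) z, eventually_corner_mul x z,
      eventually_corner_mul y z] with n h1 h2 h3
    rw [corner_add, h1, h2, h3, corner_add, add_mul]
  zero_mul x := ext_of_corner <| by
    filter_upwards [eventually_corner_mul 0 x] with n h1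
    rw [h1, corner_zero, zero_mul]
  mul_zero x := ext_of_corner <| by
    filter_upwards [eventually_corner_mul x 0] with n h1
    rw [h1, corner_zero, mul_zero]
  mul_assoc x y z := ext_of_corner <| by
    filter_upwards [eventually_corner_mul (x * y) z, eventually_corner_mul x y,
      eventually_corner_mul x (y * z), eventually_corner_mul y z] with n h1 h2 h3 h4
    rw [h1, h2, h3, h4, mul_assoc]

instance : StarRing (FinMat A) where
  star_involutive x := by ext; simp
  star_add x y := by ext; simp
  star_mul x y := ext_of_corner <| by
    filter_upwards [eventually_corner_mul x y,
      eventually_corner_mul (star y) (star x)] with n h1 h2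
    rw [corner_star, h1, h2, star_mul, corner_star, corner_star]

instance : StarModule ℂ (FinMat A) where
  star_smul c x := by ext; simp

instance : IsScalarTower ℂ (FinMat A) (FinMat A) where
  smul_assoc c x y := ext_of_corner <| by
    filter_upwards [eventually_corner_mul (c • x) y, eventually_corner_mul x y] with n h1 h2
    rw [smul_eq_mul, smul_eq_mul, h1, corner_smul, corner_smul, h2, smul_mul_assoc]

instance : SMulCommClass ℂ (FinMat A) (FinMat A) where
  smul_comm c x y := ext_of_corner <| by
    filter_upwards [eventually_corner_mul x (c • y), eventually_corner_mul x y] with n h1 h2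
    rw [smul_eq_mul, smul_eq_mul, corner_smul, h1, corner_smul, h2, mul_smul_comm]

/-- Padding an `n × n` matrix by zeros to an `m × m` matrix. -/
def padFun (n m : ℕ) (x : CStarMatrix (Fin n) (Fin n) A) : CStarMatrix (Fin m) (Fin m) A :=
  CStarMatrix.ofMatrix fun i j =>
    if hij : (i : ℕ) < n ∧ (j : ℕ) < n then x ⟨i, hij.1⟩ ⟨j, hij.2⟩ else 0

lemma padFun_apply (n m : ℕ) (x : CStarMatrix (Fin n) (Fin n) A) (i j : Fin m) :
    padFun n m x i j =
      if hij : (i : ℕ) < n ∧ (j : ℕ) < n then x ⟨i, hij.1⟩ ⟨j, hij.2⟩ else 0 := rfl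

/-- The embedding `Mₙ(A) → Mₘ(A)`, `n ≤ m`, by zero padding. -/
def pad {n m : ℕ} (h : n ≤ m) :
    CStarMatrix (Fin n) (Fin n) A →⋆ₙₐ[ℂ] CStarMatrix (Fin m) (Fin m) A where
  toFun := padFun n m
  map_smul' c x := by
    ext i j
    simp only [padFun_apply, CStarMatrix.smul_apply]
    split_ifs <;> simp
  map_zero' := by
    ext i j
    simp [padFun_apply]
  map_add' x y := by
    ext i j
    simp only [padFun_apply, CStarMatrix.add_apply]
    split_ifs <;> simp
  map_mul' x y := by
    ext i j
    simp only [padFun_apply, CStarMatrix.mul_apply]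
    by_cases hij : (i : ℕ) < n ∧ (j : ℕ) < n
    · rw [dif_pos hij]
      symm
      rw [← Finset.sum_subset (Finset.subset_univ (Finset.univ.map (Fin.castLEEmb h))),
        Finset.sum_map]
      · refine Finset.sum_congr rfl fun k _ => ?_
        simp [hij.1, hij.2]
      · intro k _ hk
        have hk' : ¬ (k : ℕ) < n := fun hlt => hk <| by
          simp only [Finset.mem_map, Finset.mem_univ, true_and]
          exact ⟨⟨k, hlt⟩, Fin.ext rfl⟩
        simp [hk']
    · rw [dif_neg hij]
      symm
      refine Finset.sum_eq_zero fun k _ => ?_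
      by_cases hi : (i : ℕ) < n
      · have hj : ¬ (j : ℕ) < n := fun hj => hij ⟨hi, hj⟩
        simp [hj]
      · simp [hi]
  map_star' x := by
    ext i j
    simp only [padFun_apply, CStarMatrix.star_apply]
    by_cases hi : (i : ℕ) < n <;> by_cases hj : (j : ℕ) < n <;> simp [hi, hj]

lemma pad_apply {n m : ℕ} (h : n ≤ m) (x : CStarMatrix (Fin n) (Fin n) A) :
    pad h x = padFun n m x := rfl

lemma pad_injective {n m : ℕ} (h : n ≤ m) : Function.Injective (pad (A := A) h) := by
  intro x y hxy
  ext i j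
  have := congrFun (congrFun hxy (Fin.castLE h i)) (Fin.castLE h j)
  simpa [pad_apply, padFun_apply] using this

lemma pad_corner {x : FinMat A} {n m : ℕ} (h : n ≤ m) (hx : x.Bound n) :
    pad h (corner n x) = corner m x := by
  ext i j
  change (if hij : (i : ℕ) < n ∧ (j : ℕ) < n then x.entry i j else 0) = x.entry i j
  split_ifs with hij
  · rfl
  · exact (hx i j (by omega)).symm

lemma norm_corner_eq {x : FinMat A} {n m : ℕ} (hn : x.Bound n) (hm : x.Bound m) :
    ‖corner n x‖ = ‖corner m x‖ := by
  wlog h : n ≤ m generalizing n m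
  · exact (this hm hn (le_of_not_ge h)).symm
  rw [← pad_corner h hn, NonUnitalStarAlgHom.norm_map (pad (A := A) h) (pad_injective h)]

/-- The norm of a finite matrix is its C⋆-norm in `Mₙ(A)`, for any `n` large enough. -/
instance : Norm (FinMat A) where
  norm x := ‖corner x.exists_bound.choose x‖

lemma norm_eq {x : FinMat A} {n : ℕ} (hn : x.Bound n) : ‖x‖ = ‖corner n x‖ :=
  norm_corner_eq x.exists_bound.choose_spec hn

lemma eventually_norm (x : FinMat A) : ∀ᶠ n in atTop, ‖x‖ = ‖corner n x‖ :=
  x.eventually_bound.mono fun _ h => norm_eq h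

lemma normCore : NormedSpace.Core ℂ (FinMat A) where
  norm_nonneg x := norm_nonneg (corner _ x)
  norm_smul c x := by
    obtain ⟨n, h1, h2⟩ := ((eventually_norm (c • x)).and (eventually_norm x)).exists
    rw [h1, h2, corner_smul, norm_smul]
  norm_triangle x y := by
    obtain ⟨n, h1, h2, h3⟩ :=
      ((eventually_norm (x + y)).and ((eventually_norm x).and (eventually_norm y))).exists
    rw [h1, h2, h3, corner_add]
    exact norm_add_le _ _
  norm_eq_zero_iff x := by
    constructor
    · intro h
      refine ext_of_corner ?_
      filter_upwards [eventually_norm x] with n hn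
      rw [corner_zero, ← norm_eq_zero, ← hn, h]
    · rintro rfl
      obtain ⟨n, h1⟩ := (eventually_norm (0 : FinMat A)).exists
      rw [h1, corner_zero, norm_zero]

instance : NormedAddCommGroup (FinMat A) := NormedAddCommGroup.ofCore normCore

instance : NormedSpace ℂ (FinMat A) where
  norm_smul_le c x := (normCore.norm_smul c x).le

lemma norm_mul_le' (x y : FinMat A) : ‖x * y‖ ≤ ‖x‖ * ‖y‖ := by
  obtain ⟨n, h1, h2, h3, h4⟩ := ((eventually_norm (x * y)).and ((eventually_norm x).and
    ((eventually_norm y).and (eventually_corner_mul x y)))).exists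
  rw [h1, h2, h3, h4]
  exact norm_mul_le _ _

lemma norm_star' (x : FinMat A) : ‖star x‖ = ‖x‖ := by
  obtain ⟨n, h1, h2⟩ := ((eventually_norm (star x)).and (eventually_norm x)).exists
  rw [h1, h2, corner_star, norm_star]

lemma norm_star_mul (x : FinMat A) : ‖x‖ * ‖x‖ ≤ ‖star x * x‖ := by
  obtain ⟨n, h1, h2, h3⟩ := ((eventually_norm (star x * x)).and ((eventually_norm x).and
    (eventually_corner_mul (star x) x))).exists
  rw [h1, h2, h3, corner_star, CStarRing.norm_star_mul_self]

instance : NonUnitalNormedRing (FinMat A) where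
  __ := (inferInstance : NormedAddCommGroup (FinMat A))
  __ := (inferInstance : NonUnitalRing (FinMat A))
  norm_mul_le := norm_mul_le'

instance : NormedStarGroup (FinMat A) where
  norm_star_le x := (norm_star' x).le

lemma norm_entry_le (x : FinMat A) (i j : ℕ) : ‖x.entry i j‖ ≤ ‖x‖ := by
  obtain ⟨n, h, hi, hj⟩ := ((eventually_norm x).and
    ((eventually_gt_atTop i).and (eventually_gt_atTop j))).exists
  rw [h]
  exact CStarMatrix.norm_entry_le_norm (M := corner n x) (i := ⟨i, hi⟩) (j := ⟨j, hj⟩)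

end FinMat

variable (A)

/-- The stabilization `A ⊗ 𝒦` (with `𝒦` the compact operators on `ℓ²`): the completion of
`⋃ₙ Mₙ(A)` in its C⋆-norm. -/
def Stab : Type u := UniformSpace.Completion (FinMat A)

variable {A}

namespace Stab

open UniformSpace

instance : NormedAddCommGroup (Stab A) :=
  inferInstanceAs (NormedAddCommGroup (Completion (FinMat A)))
instance : NormedSpace ℂ (Stab A) := inferInstanceAs (NormedSpace ℂ (Completion (FinMat A)))
instance : CompleteSpace (Stab A) := inferInstanceAs (CompleteSpace (Completion (FinMat A)))

/-- The inclusion of the finite matrices. -/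
def of (x : FinMat A) : Stab A := (x : Completion (FinMat A))

lemma of_add (x y : FinMat A) : of (x + y) = of x + of y := Completion.coe_add x y
lemma of_smul (c : ℂ) (x : FinMat A) : of (c • x) = c • of x := Completion.coe_smul c x
lemma of_zero : of (0 : FinMat A) = 0 := Completion.coe_zero
lemma norm_of (x : FinMat A) : ‖of x‖ = ‖x‖ := Completion.norm_coe x
lemma continuous_of : Continuous (of : FinMat A → Stab A) :=
  Completion.continuous_coe (FinMat A)
lemma isDenseInducing_of : IsDenseInducing (of : FinMat A → Stab A) :=
  Completion.isDenseInducing_coe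
lemma denseRange_of : DenseRange (of : FinMat A → Stab A) := isDenseInducing_of.dense

/-- Multiplication, extended by continuity. -/
instance : Mul (Stab A) where
  mul x y := (isDenseInducing_of.prodMap isDenseInducing_of).extend
    (fun p : FinMat A × FinMat A => of (p.1 * p.2)) (x, y)

/-- The involution, extended by continuity. -/
instance : Star (Stab A) where
  star := Completion.extension fun x : FinMat A => of (star x)

lemma of_mul (x y : FinMat A) : of (x * y) = of x * of y :=
  ((isDenseInducing_of.prodMap isDenseInducing_of).extend_eq
    (continuous_of.comp continuous_mul) (x, y)).symm

lemma continuous_mul' : Continuous fun p : Stab A × Stab A => p.1 * p.2 := by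
  let j : FinMat A →+ Stab A := ⟨⟨of, of_zero⟩, of_add⟩
  let m : FinMat A →+ FinMat A →+ Stab A := (AddMonoidHom.mul : FinMat A →+ _).compr₂ j
  have hm : Continuous fun p : FinMat A × FinMat A => m p.1 p.2 :=
    continuous_of.comp continuous_mul
  have di : IsDenseInducing (j : FinMat A → Stab A) := isDenseInducing_of
  exact di.extend_Z_bilin di hm

lemma uniformContinuous_of_star : UniformContinuous fun x : FinMat A => of (star x) :=
  (Completion.uniformContinuous_coe (FinMat A)).comp
    (starNormedAddGroupHom (E := FinMat A)).uniformContinuous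

lemma of_star (x : FinMat A) : of (star x) = star (of x) :=
  (Completion.extension_coe uniformContinuous_of_star x).symm

lemma continuous_star' : Continuous fun x : Stab A => star x :=
  Completion.continuous_extension (f := fun x : FinMat A => of (star x))

instance : ContinuousMul (Stab A) := ⟨continuous_mul'⟩
instance : ContinuousStar (Stab A) := ⟨continuous_star'⟩

@[elab_as_elim] lemma induction₁ {p : Stab A → Prop} (x : Stab A) (hp : IsClosed {x | p x})
    (h : ∀ x, p (of x)) : p x := Completion.induction_on x hp h

@[elab_as_elim] lemma induction₂ {p : Stab A → Stab A → Prop} (x y : Stab A)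
    (hp : IsClosed {q : Stab A × Stab A | p q.1 q.2}) (h : ∀ x y, p (of x) (of y)) : p x y :=
  Completion.induction_on₂ x y hp h

@[elab_as_elim] lemma induction₃ {p : Stab A → Stab A → Stab A → Prop} (x y z : Stab A)
    (hp : IsClosed {q : Stab A × Stab A × Stab A | p q.1 q.2.1 q.2.2})
    (h : ∀ x y z, p (of x) (of y) (of z)) : p x y z :=
  Completion.induction_on₃ x y z hp h

instance : NonUnitalRing (Stab A) where
  __ := (inferInstance : AddCommGroup (Stab A))
  mul := (· * ·)
  left_distrib x y z := induction₃ x y z (isClosed_eq (by fun_prop) (by fun_prop))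
    fun x y z => by simp only [← of_mul, ← of_add, mul_add]
  right_distrib x y z := induction₃ x y z (isClosed_eq (by fun_prop) (by fun_prop))
    fun x y z => by simp only [← of_mul, ← of_add, add_mul]
  zero_mul x := induction₁ x (isClosed_eq (by fun_prop) (by fun_prop))
    fun x => by rw [← of_zero, ← of_mul, zero_mul]
  mul_zero x := induction₁ x (isClosed_eq (by fun_prop) (by fun_prop))
    fun x => by rw [← of_zero, ← of_mul, mul_zero]
  mul_assoc x y z := induction₃ x y z (isClosed_eq (by fun_prop) (by fun_prop))
    fun x y z => by simp only [← of_mul, mul_assoc]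

instance : NonUnitalNormedRing (Stab A) where
  __ := (inferInstance : NormedAddCommGroup (Stab A))
  __ := (inferInstance : NonUnitalRing (Stab A))
  norm_mul_le x y := induction₂ x y (isClosed_le (by fun_prop) (by fun_prop))
    fun x y => by simpa only [← of_mul, norm_of] using norm_mul_le x y

instance : StarRing (Stab A) where
  star_involutive x := induction₁ x (isClosed_eq (by fun_prop) (by fun_prop))
    fun x => by rw [← of_star, ← of_star, star_star]
  star_add x y := induction₂ x y (isClosed_eq (by fun_prop) (by fun_prop))
    fun x y => by simp only [← of_star, ← of_add, star_add]
  star_mul x y := induction₂ x y (isClosed_eq (by fun_prop) (by fun_prop))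
    fun x y => by simp only [← of_star, ← of_mul, star_mul]

lemma smul_mul' (c : ℂ) (x y : Stab A) : c • x * y = c • (x * y) :=
  induction₂ x y (isClosed_eq
      ((continuous_fst.const_smul c).mul continuous_snd)
      ((continuous_fst.mul continuous_snd).const_smul c))
    fun x y => by rw [← of_smul, ← of_mul, ← of_mul, ← of_smul, smul_mul_assoc]

lemma mul_smul' (c : ℂ) (x y : Stab A) : x * c • y = c • (x * y) :=
  induction₂ x y (isClosed_eq
      (continuous_fst.mul (continuous_snd.const_smul c))
      ((continuous_fst.mul continuous_snd).const_smul c))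
    fun x y => by rw [← of_smul, ← of_mul, ← of_mul, ← of_smul, mul_smul_comm]

instance : IsScalarTower ℂ (Stab A) (Stab A) := ⟨smul_mul'⟩
instance : SMulCommClass ℂ (Stab A) (Stab A) := ⟨fun c x y => (mul_smul' c x y).symm⟩

instance : StarModule ℂ (Stab A) where
  star_smul c x := induction₁ x
    (isClosed_eq (continuous_star.comp (continuous_const_smul c))
      (continuous_star.const_smul (star c)))
    fun x => by rw [← of_star, ← of_smul, ← of_star, ← of_smul, star_smul]

instance : CStarRing (Stab A) where
  norm_mul_self_le x := induction₁ x (isClosed_le (by fun_prop) (by fun_prop))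
    fun x => by simpa only [← of_star, ← of_mul, norm_of] using FinMat.norm_star_mul x

instance : NonUnitalCStarAlgebra (Stab A) where
  __ := (inferInstance : NormedSpace ℂ (Stab A))
  smul_assoc := smul_assoc
  smul_comm := smul_comm
  star_smul := star_smul

instance : PartialOrder (Stab A) := CStarAlgebra.spectralOrder _
instance : StarOrderedRing (Stab A) := CStarAlgebra.spectralOrderedRing _

/-- The `(i, j)` entry of an element of `A ⊗ 𝒦`, viewed as an infinite matrix over `A`. -/
def entry (i j : ℕ) : Stab A → A :=
  Completion.extension fun x : FinMat A => x.entry i j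

lemma uniformContinuous_entry (i j : ℕ) :
    UniformContinuous fun x : FinMat A => x.entry i j := by
  let l : FinMat A →ₗ[ℂ] A :=
    { toFun := fun x => x.entry i j, map_add' := fun _ _ => rfl, map_smul' := fun _ _ => rfl }
  exact (l.mkContinuous 1 fun x => by
    rw [one_mul]
    exact FinMat.norm_entry_le x i j).uniformContinuous

lemma entry_of (i j : ℕ) (x : FinMat A) : entry i j (of x) = x.entry i j :=
  Completion.extension_coe (uniformContinuous_entry i j) x

lemma continuous_entry (i j : ℕ) : Continuous (entry i j : Stab A → A) :=
  Completion.continuous_extension (f := fun x : FinMat A => x.entry i j)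

end Stab

end Stabilization

/-! ### Notions for a general C⋆-algebra -/

section Basic

variable {A : Type u} [NonUnitalCStarAlgebra A] [PartialOrder A] [StarOrderedRing A]

/-- Cuntz subequivalence `a ≲ b`: there are `xₙ` with `xₙ* b xₙ → a` in norm. -/
def CuntzLE (a b : A) : Prop :=
  ∃ x : ℕ → A, Tendsto (fun n => star (x n) * b * x n) atTop (𝓝 a)

/-- `a` is a strictly positive element of `A`: `a ≥ 0` and `aAa` is dense in `A`. -/
def IsStrictlyPos (a : A) : Prop :=
  0 ≤ a ∧ Dense (Set.range fun x : A => a * x * a)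

variable (A) in
/-- `A` is σ-unital: it has a strictly positive element. -/
def IsSigmaUnital : Prop := ∃ a : A, IsStrictlyPos a

variable (A) in
/-- `A` is a simple C⋆-algebra: nonzero, with no nontrivial closed two-sided ideal. -/
def IsSimpleCStar : Prop :=
  Nontrivial A ∧ ∀ I : TwoSidedIdeal A, IsClosed (I : Set A) → I = ⊥ ∨ I = ⊤

variable (A) in
/-- `A` is elementary: it is `*`-isomorphic to the algebra of compact operators on some
Hilbert space. -/
def IsElementary : Prop :=
  ∃ (H : Type u) (_ : NormedAddCommGroup H) (_ : InnerProductSpace ℂ H) (_ : CompleteSpace H)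
    (π : A →⋆ₙₐ[ℂ] (H →L[ℂ] H)),
    Function.Injective π ∧ Set.range π = {T : H →L[ℂ] H | IsCompactOperator T}

/-- An increasing approximate unit `(eₙ)` of `A` with `eₙ₊₁ eₙ = eₙ eₙ₊₁ = eₙ`. -/
structure IsNestedApproxUnit (e : ℕ → A) : Prop where
  nonneg : ∀ n, 0 ≤ e n
  norm_le : ∀ n, ‖e n‖ ≤ 1
  mono : Monotone e
  tendsto_left : ∀ x, Tendsto (fun n => e n * x) atTop (𝓝 x)
  tendsto_right : ∀ x, Tendsto (fun n => x * e n) atTop (𝓝 x)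
  succ_mul : ∀ n, e (n + 1) * e n = e n
  mul_succ : ∀ n, e n * e (n + 1) = e n

variable (A) in
/-- `A` has continuous scale. -/
def HasContinuousScale : Prop :=
  ∃ e : ℕ → A, IsNestedApproxUnit e ∧
    ∀ b : A, 0 ≤ b → b ≠ 0 → ∃ N : ℕ, ∀ m n : ℕ, N ≤ n → n < m → CuntzLE (e m - e n) b

variable (A) in
/-- The Pedersen ideal: the smallest dense two-sided ideal of `A`. -/
def Ped : Set A := {x | ∀ I : TwoSidedIdeal A, Dense (I : Set A) → x ∈ I}

variable (A) in
/-- The cone `T̃(A)` of densely defined lower semicontinuous positive traces on `A`, as functions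
`A₊ → [0, ∞]`. So that traces are determined by their values on `A₊`, the value
outside `A₊` is set to `0`. -/
@[ext] structure LscTrace where
  toFun : A → ℝ≥0∞
  map_add : ∀ a b, 0 ≤ a → 0 ≤ b → toFun (a + b) = toFun a + toFun b
  map_smul : ∀ (c : ℝ≥0) (a : A), 0 ≤ a → toFun ((c : ℝ) • a) = c * toFun a
  map_star_mul : ∀ x : A, toFun (star x * x) = toFun (x * star x)
  lsc : LowerSemicontinuousOn toFun {a | 0 ≤ a}
  dense : {a : A | 0 ≤ a} ⊆ closure {a : A | 0 ≤ a ∧ toFun a < ∞}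
  outside : ∀ a, ¬ 0 ≤ a → toFun a = 0

instance : CoeFun (LscTrace A) fun _ => A → ℝ≥0∞ := ⟨LscTrace.toFun⟩

/-- The topology of `T̃(A)`: pointwise convergence on (positive elements of) the Pedersen
ideal. -/
instance : TopologicalSpace (LscTrace A) :=
  TopologicalSpace.induced
    (fun (τ : LscTrace A) (b : {b : A // 0 ≤ b ∧ b ∈ Ped A}) => τ b) Pi.topologicalSpace

variable (A) in
/-- The set `T(A)` of tracial states, as a subset of `T̃(A)`: those `τ` that are the restriction
to `A₊` of a positive linear functional `φ` with `‖φ‖ = 1` and `φ(xy) = φ(yx)`. -/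
def tracialStates : Set (LscTrace A) :=
  {τ | ∃ φ : A →L[ℂ] ℂ, (∀ a : A, 0 ≤ a → 0 ≤ φ a) ∧ ‖φ‖ = 1 ∧
    (∀ x y : A, φ (x * y) = φ (y * x)) ∧ ∀ a : A, 0 ≤ a → τ a = ENNReal.ofReal (φ a).re}

/-- `f_ε` is `0` on `(-∞, ε/2]`, `1` on `[ε, ∞)` and affine in between. -/
def cutoff (ε t : ℝ) : ℝ := min 1 (max 0 ((t - ε / 2) / (ε / 2)))

/-- `d_τ(a) = lim_{ε → 0} τ(f_ε(a))`. Since `f_ε(a)` increases as `ε` decreases, the limit is the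
supremum over `0 < ε < 1`. -/
def dim (τ : LscTrace A) (a : A) : ℝ≥0∞ :=
  ⨆ ε ∈ Set.Ioo (0 : ℝ) 1, τ (cfcₙ (cutoff ε) a)

/-- The extension of `τ` to `(A ⊗ 𝒦)₊` with `τ(a ⊗ b) = τ(a) Tr(b)`. -/
def stabTrace (τ : LscTrace A) (a : Stab A) : ℝ≥0∞ := ∑' i, τ (Stab.entry i i a)

/-- `d_τ(a)` for `a` in `(A ⊗ 𝒦)₊`. -/
def stabDim (τ : LscTrace A) (a : Stab A) : ℝ≥0∞ :=
  ⨆ ε ∈ Set.Ioo (0 : ℝ) 1, stabTrace τ (cfcₙ (cutoff ε) a)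

variable (A) in
/-- Strict comparison for positive elements using traces: for `a, b ∈ (A ⊗ 𝒦)₊`, if
`d_τ(a) < d_τ(b) < ∞` for all nonzero `τ` in `T̃(A)`, then `a ≲ b`. The condition `b ≠ 0` follows
from the inequality unless `T̃(A) = {0}`, when the inequality is void. -/
def HasStrictComparison : Prop :=
  ∀ a b : Stab A, 0 ≤ a → 0 ≤ b → b ≠ 0 →
    (∀ τ : LscTrace A, (∃ x, τ x ≠ 0) → stabDim τ a < stabDim τ b ∧ stabDim τ b < ∞) →
    CuntzLE a b

end Basic

end ConScale

end

noncomputable section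

/-! Everything reduces to the function `LscTrace.mass`, the norm of a trace. For strictly positive
`a` the elements `f_ε(a)` form an approximate unit, so `d_τ(a)` is the mass of `τ`, whatever `a` is
(`IsStrictlyPos.dim_eq_mass`). Tracial states are exactly the traces of mass 1
(`mem_tracialStates_iff`), and the traces of mass at most 1 form a compact set, as in Banach–Alaoglu
(`isCompact_mass_le_one`). So if the mass is continuous on the closure of `T(A)`, it equals 1 there,
and `T(A)` is closed in a compact set.

Continuous scale makes the mass continuous. It is a supremum of the continuous functions `τ(e_n)`,
hence lower semicontinuous. For each `k` some `b ≠ 0` satisfies `k d_τ(b) ≤ τ(e_L)` for all `τ`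
(`exists_mul_dim_le`). Tails of `(e_n)` are Cuntz below `b`, so they carry at most about a `k`-th of
the mass, uniformly in `τ`, and upper semicontinuity follows (`HasContinuousScale.continuous_mass`).

Conversely, let `T(A)` be compact and `‖b‖ = 1`. Since `τ(e_n)` increases to 1 and `τ(b) > 0`,
compactness gives one `n` with `1 - τ(e_n) < τ(b)` on all of `T(A)`. Later tails then have smaller
dimension than `b`, and strict comparison puts them below `b` (`hasContinuousScale_of_isCompact`).
-/

namespace ConScale

variable {A : Type*} [NonUnitalCStarAlgebra A] [PartialOrder A] [StarOrderedRing A]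

/-! ### Inequalities for traces, and the mass of a trace -/

namespace LscTrace

variable (τ : LscTrace A)

lemma map_zero : τ 0 = 0 := by simpa using τ.map_smul 0 0 le_rfl

lemma mono {a b : A} (ha : 0 ≤ a) (hab : a ≤ b) : τ a ≤ τ b := by
  have := τ.map_add a (b - a) ha (sub_nonneg.2 hab)
  rw [add_sub_cancel] at this
  exact this ▸ le_self_add

lemma map_smul_real {c : ℝ} (hc : 0 ≤ c) {a : A} (ha : 0 ≤ a) :
    τ (c • a) = ENNReal.ofReal c * τ a :=
  τ.map_smul ⟨c, hc⟩ a ha |>.trans (by rw [ENNReal.ofReal_eq_coe_nnreal hc]; rfl)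

/-- The trace identity turns `x* b x` into `√b x x* √b`, which lies below `‖x‖² b`. -/
lemma conj_le {b : A} (hb : 0 ≤ b) (x : A) :
    τ (star x * b * x) ≤ ENNReal.ofReal (‖x‖ ^ 2) * τ b := by
  have hs : star (CFC.sqrt b) = CFC.sqrt b := (CFC.sqrt_nonneg b).isSelfAdjoint
  have hss := CFC.sqrt_mul_sqrt_self b hb
  have h1 : star x * b * x = star (CFC.sqrt b * x) * (CFC.sqrt b * x) := by
    rw [star_mul, hs, ← hss, CFC.sqrt_mul_self _ (CFC.sqrt_nonneg b)]
    simp only [mul_assoc]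
  have h2 : CFC.sqrt b * x * star (CFC.sqrt b * x) ≤ ‖x‖ ^ 2 • b := by
    have := CStarAlgebra.star_right_conjugate_le_norm_smul (a := CFC.sqrt b) (b := x * star x)
    rw [CStarRing.norm_self_mul_star, hs, hss, ← sq] at this
    simpa only [star_mul, mul_assoc, hs] using this
  rw [h1, τ.map_star_mul, ← τ.map_smul_real (sq_nonneg _) hb]
  exact τ.mono (mul_star_self_nonneg _) h2

lemma conj_sqrt_le {b f : A} (hb : 0 ≤ b) (hf : 0 ≤ f) (hf1 : ‖f‖ ≤ 1) :
    τ (star (CFC.sqrt f) * b * CFC.sqrt f) ≤ τ b := by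
  have hn : ‖CFC.sqrt f‖ ^ 2 ≤ 1 := by
    rw [sq, ← CStarRing.norm_star_mul_self, (CFC.sqrt_nonneg f).isSelfAdjoint.star_eq,
      CFC.sqrt_mul_sqrt_self f hf]
    exact hf1
  calc _ ≤ ENNReal.ofReal (‖CFC.sqrt f‖ ^ 2) * τ b := τ.conj_le hb _
    _ ≤ 1 * τ b := by gcongr; exact ENNReal.ofReal_le_one.2 hn
    _ = _ := one_mul _

/-- Lower semicontinuity in the form used below, with bounds that may vary along the filter. -/
lemma le_of_tendsto {ι : Type*} {l : Filter ι} [l.NeBot] {u : ι → A} {a : A} {c : ι → ℝ≥0∞}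
    {C : ℝ≥0∞} (hu : ∀ i, 0 ≤ u i) (h : Tendsto u l (𝓝 a)) (hc : Tendsto c l (𝓝 C))
    (hle : ∀ i, τ (u i) ≤ c i) : τ a ≤ C := by
  have ha : 0 ≤ a := CStarAlgebra.isClosed_nonneg.mem_of_tendsto h (.of_forall hu)
  by_contra! hlt
  obtain ⟨y, hy1, hy2⟩ := exists_between hlt
  have h1 := (tendsto_nhdsWithin_iff.2 ⟨h, .of_forall hu⟩).eventually (τ.lsc a ha y hy2)
  obtain ⟨i, h3, h4⟩ := (h1.and (hc.eventually (gt_mem_nhds hy1))).exists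
  exact (h3.trans_le (hle i)).not_gt h4

/-- The supremum of `τ` on the positive part of the closed unit ball. -/
def mass : ℝ≥0∞ := ⨆ b : {b : A // 0 ≤ b ∧ ‖b‖ ≤ 1}, τ b

lemma le_mass {b : A} (hb : 0 ≤ b) (hb1 : ‖b‖ ≤ 1) : τ b ≤ τ.mass :=
  le_iSup (fun b : {b : A // 0 ≤ b ∧ ‖b‖ ≤ 1} => τ b) ⟨b, hb, hb1⟩

lemma le_norm_mul_mass {b : A} (hb : 0 ≤ b) : τ b ≤ ENNReal.ofReal ‖b‖ * τ.mass := by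
  rcases eq_or_ne b 0 with rfl | h0
  · simp [τ.map_zero]
  have hpos : 0 < ‖b‖ := norm_pos_iff.2 h0
  have h := τ.le_mass (b := ‖b‖⁻¹ • b) (smul_nonneg (by positivity) hb)
    (by rw [norm_smul, norm_inv, norm_norm, inv_mul_cancel₀ hpos.ne'])
  calc τ b = τ (‖b‖ • ‖b‖⁻¹ • b) := by rw [smul_inv_smul₀ hpos.ne']
    _ = ENNReal.ofReal ‖b‖ * τ (‖b‖⁻¹ • b) :=
        τ.map_smul_real (norm_nonneg _) (smul_nonneg (by positivity) hb)
    _ ≤ _ := by gcongr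

/-- For `b` in the positive unit ball, `√b u_n √b` tends to `b` and has trace at most `τ(u_n)`. -/
lemma mass_eq_iSup {u : ℕ → A} (hu : ∀ n, 0 ≤ u n) (hu1 : ∀ n, ‖u n‖ ≤ 1)
    (h : ∀ x, Tendsto (fun n => u n * x) atTop (𝓝 x)) : τ.mass = ⨆ n, τ (u n) := by
  refine le_antisymm (iSup_le fun ⟨b, hb, hb1⟩ => ?_) (iSup_le fun n => τ.le_mass (hu n) (hu1 n))
  have hs : star (CFC.sqrt b) = CFC.sqrt b := (CFC.sqrt_nonneg b).isSelfAdjoint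
  have hss := CFC.sqrt_mul_sqrt_self b hb
  refine τ.le_of_tendsto (l := atTop) (u := fun n => star (CFC.sqrt b) * u n * CFC.sqrt b)
    (fun n => star_left_conjugate_nonneg (hu n) _) ?_ tendsto_const_nhds fun n => ?_
  · have := (h (CFC.sqrt b)).const_mul (CFC.sqrt b)
    simpa only [hs, hss, mul_assoc] using this
  · exact (τ.conj_sqrt_le (hu n) hb hb1).trans (le_iSup (fun n => τ (u n)) n)

/-- By the C⋆-identity `h` also fixes `√f`, so `f = √f h √f`, a compression of `h` by a contraction.
-/
lemma le_of_mul_eq {h f : A} (hh : 0 ≤ h) (hf : 0 ≤ f) (hf1 : ‖f‖ ≤ 1)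
    (hhf : h * f = f) : τ f ≤ τ h := by
  have hfh : f * h = f := by
    simpa [hh.isSelfAdjoint.star_eq, hf.isSelfAdjoint.star_eq] using congrArg star hhf
  have hs : star (CFC.sqrt f) = CFC.sqrt f := (CFC.sqrt_nonneg f).isSelfAdjoint
  have hss := CFC.sqrt_mul_sqrt_self f hf
  have key : star (CFC.sqrt f) * h * CFC.sqrt f = f := by
    have h0 : (h * CFC.sqrt f - CFC.sqrt f) = 0 := by
      rw [← CStarRing.mul_star_self_eq_zero_iff, star_sub, star_mul, hs, hh.isSelfAdjoint.star_eq]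
      have : (h * CFC.sqrt f - CFC.sqrt f) * (CFC.sqrt f * h - CFC.sqrt f)
        = h * (CFC.sqrt f * CFC.sqrt f) * h - h * (CFC.sqrt f * CFC.sqrt f)
          - (CFC.sqrt f * CFC.sqrt f) * h + CFC.sqrt f * CFC.sqrt f := by noncomm_ring
      rw [this, hss, hhf, hfh]; abel
    rw [mul_assoc, sub_eq_zero.1 h0, hs, hss]
  calc τ f = τ (star (CFC.sqrt f) * h * CFC.sqrt f) := by rw [key]
    _ ≤ τ h := τ.conj_sqrt_le hh hf hf1

end LscTrace

/-! ### The functions `f_ε` -/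

lemma continuous_cutoff (ε : ℝ) : Continuous (cutoff ε) := by unfold cutoff; fun_prop

lemma cutoff_nonneg (ε t : ℝ) : 0 ≤ cutoff ε t := le_min zero_le_one (le_max_left _ _)

lemma cutoff_le_one (ε t : ℝ) : cutoff ε t ≤ 1 := min_le_left _ _

lemma cutoff_of_le {ε t : ℝ} (hε : 0 < ε) (h : t ≤ ε / 2) : cutoff ε t = 0 := by
  have : (t - ε / 2) / (ε / 2) ≤ 0 := div_nonpos_of_nonpos_of_nonneg (by linarith) (by positivity)
  rw [cutoff, max_eq_left this, min_eq_right zero_le_one]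

lemma cutoff_of_ge {ε t : ℝ} (hε : 0 < ε) (h : ε ≤ t) : cutoff ε t = 1 := by
  have : 1 ≤ (t - ε / 2) / (ε / 2) := by rw [le_div_iff₀ (by positivity)]; linarith
  rw [cutoff, min_eq_left (this.trans (le_max_right _ _))]

lemma cutoff_zero {ε : ℝ} (hε : 0 < ε) : cutoff ε 0 = 0 := cutoff_of_le hε (by positivity)

lemma cutoff_mul_cutoff {ε δ t : ℝ} (hε : 0 < ε) (h : ε ≤ δ / 2) :
    cutoff ε t * cutoff δ t = cutoff δ t := by
  rcases le_total t (δ / 2) with ht | ht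
  · rw [cutoff_of_le (by linarith) ht, mul_zero]
  · rw [cutoff_of_ge hε (h.trans ht), one_mul]

lemma cutoff_anti {ε δ t : ℝ} (hε : 0 < ε) (h : ε ≤ δ) : cutoff δ t ≤ cutoff ε t := by
  rcases le_total t (ε / 2) with ht | ht
  · rw [cutoff_of_le (hε.trans_le h) (by linarith), cutoff_of_le hε ht]
  · have : (t - δ / 2) / (δ / 2) ≤ (t - ε / 2) / (ε / 2) := by
      rw [div_le_div_iff₀ (by linarith) (by linarith)]
      nlinarith
    unfold cutoff
    gcongr

lemma cfcₙ_cutoff_nonneg (ε : ℝ) (a : A) : 0 ≤ cfcₙ (cutoff ε) a :=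
  cfcₙ_nonneg fun t _ => cutoff_nonneg ε t

lemma norm_cfcₙ_cutoff_le (ε : ℝ) (a : A) : ‖cfcₙ (cutoff ε) a‖ ≤ 1 :=
  norm_cfcₙ_le fun t _ => by
    rw [Real.norm_of_nonneg (cutoff_nonneg ε t)]; exact cutoff_le_one ε t

lemma exists_cfcₙ_cutoff_eq {a : A} (ha : 0 ≤ a) {ε : ℝ} (hε : 0 < ε) :
    ∃ c : A, 0 ≤ c ∧ cfcₙ (cutoff ε) a = c * a * c ∧ cfcₙ (cutoff ε) a = a * (c * c) := by
  -- This is `√(f_ε(t)/t)`. The maximum keeps it continuous at `0` and changes nothing where `f_ε ≠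
  -- 0`.
  let k : ℝ → ℝ := fun t => √(cutoff ε t / max t (ε / 2))
  have hm (t : ℝ) : 0 < max t (ε / 2) := lt_max_of_lt_right (by positivity)
  have hk : Continuous k := by
    refine Real.continuous_sqrt.comp ?_
    exact (continuous_cutoff ε).div (by fun_prop) fun t => (hm t).ne'
  have hk0 : k 0 = 0 := by simp [k, cutoff_zero hε]
  have hkk (t : ℝ) : t * (k t * k t) = cutoff ε t := by
    rw [Real.mul_self_sqrt (div_nonneg (cutoff_nonneg _ _) (hm t).le)]
    rcases le_total t (ε / 2) with ht | ht
    · rw [cutoff_of_le hε ht]; simp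
    · rw [max_eq_left ht, mul_div_cancel₀]; linarith
  have hid : cfcₙ (fun t : ℝ => t) a = a := cfcₙ_id' ℝ a
  have h1 : cfcₙ (cutoff ε) a = a * (cfcₙ k a * cfcₙ k a) := by
    conv_rhs => rw [← hid]
    rw [hid, ← cfcₙ_mul k k a hk.continuousOn hk0 hk.continuousOn hk0]
    nth_rewrite 2 [← hid]
    rw [← cfcₙ_mul (fun t => t) (fun t => k t * k t) a continuousOn_id rfl
      (hk.mul hk).continuousOn (by simp [hk0])]
    exact cfcₙ_congr fun t _ => (hkk t).symm
  have hcomm : cfcₙ k a * a = a * cfcₙ k a := by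
    have := cfcₙ_commute_cfcₙ k (fun t : ℝ => t) a
    rw [hid] at this
    exact this
  exact ⟨cfcₙ k a, cfcₙ_nonneg fun t _ => Real.sqrt_nonneg _, by rw [h1, hcomm, mul_assoc], h1⟩

lemma norm_cutoff_mul_sub_le {a : A} (ha : 0 ≤ a) {ε : ℝ} (hε : 0 < ε) :
    ‖cfcₙ (cutoff ε) a * a - a‖ ≤ ε := by
  have hid : cfcₙ (fun t : ℝ => t) a = a := cfcₙ_id' ℝ a
  have hc := continuous_cutoff ε
  have h0 := cutoff_zero hε
  have : cfcₙ (cutoff ε) a * a - a = cfcₙ (fun t => cutoff ε t * t - t) a := by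
    rw [cfcₙ_sub (fun t => cutoff ε t * t) (fun t => t) a (by fun_prop) (by simp) (by fun_prop) rfl,
      cfcₙ_mul (cutoff ε) (fun t => t) a hc.continuousOn h0 (by fun_prop) rfl, hid]
  rw [this]
  refine norm_cfcₙ_le fun t ht => ?_
  have ht0 : 0 ≤ t := quasispectrum_nonneg_of_nonneg a ha t ht
  have h1 := cutoff_nonneg ε t
  have h2 := cutoff_le_one ε t
  rw [Real.norm_eq_abs, abs_le]
  rcases le_total ε t with h | h
  · rw [cutoff_of_ge hε h]; constructor <;> linarith
  · constructor <;> nlinarith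

/-- A sequence in `(0, 1)` decreasing to `0` so fast that the corresponding `f_ε` are nested. -/
def dyadic (n : ℕ) : ℝ := (1 / 2) ^ (n + 1)

lemma dyadic_mem (n : ℕ) : dyadic n ∈ Ioo (0 : ℝ) 1 :=
  ⟨by unfold dyadic; positivity, pow_lt_one₀ (by norm_num) (by norm_num) (by simp)⟩

lemma dyadic_succ (n : ℕ) : dyadic (n + 1) = dyadic n / 2 := by
  simp only [dyadic, pow_succ]; ring

lemma tendsto_dyadic : Tendsto dyadic atTop (𝓝 0) :=
  (tendsto_pow_atTop_nhds_zero_of_lt_one (by norm_num) (by norm_num)).comp (tendsto_add_atTop_nat 1)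

lemma tendsto_cutoff_mul {a : A} (ha : 0 ≤ a) :
    Tendsto (fun n => cfcₙ (cutoff (dyadic n)) a * a) atTop (𝓝 a) := by
  rw [tendsto_iff_norm_sub_tendsto_zero]
  exact squeeze_zero (fun _ => norm_nonneg _)
    (fun n => norm_cutoff_mul_sub_le ha (dyadic_mem n).1) tendsto_dyadic

/-! ### Dimension functions and Cuntz subequivalence -/

lemma le_dim (τ : LscTrace A) (a : A) {ε : ℝ} (hε : ε ∈ Ioo (0 : ℝ) 1) :
    τ (cfcₙ (cutoff ε) a) ≤ dim τ a :=
  le_iSup₂ (f := fun (ε : ℝ) (_ : ε ∈ Ioo (0 : ℝ) 1) => τ (cfcₙ (cutoff ε) a)) ε hε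

lemma dim_le_mass (τ : LscTrace A) (a : A) : dim τ a ≤ τ.mass :=
  iSup₂_le fun ε _ => τ.le_mass (cfcₙ_cutoff_nonneg ε a) (norm_cfcₙ_cutoff_le ε a)

lemma dim_le_of_mul_eq (τ : LscTrace A) {a h : A} (ha : 0 ≤ a) (hh : 0 ≤ h)
    (hha : h * a = a) : dim τ a ≤ τ h := by
  refine iSup₂_le fun ε hε => ?_
  obtain ⟨c, -, -, hc⟩ := exists_cfcₙ_cutoff_eq ha hε.1
  refine τ.le_of_mul_eq hh (cfcₙ_cutoff_nonneg ε a) (norm_cfcₙ_cutoff_le ε a) ?_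
  rw [hc, ← mul_assoc, hha]

/-- With `y = √b x`, the elements `y* f_ε(b) y` tend to `y* y = x* b x`. The constant is `‖x* b x‖`
and not `‖x‖²`: along a Cuntz sequence the former converges, while `‖x_n‖` may be unbounded. -/
lemma conj_le_dim (τ : LscTrace A) {b : A} (hb : 0 ≤ b) (x : A) :
    τ (star x * b * x) ≤ ENNReal.ofReal ‖star x * b * x‖ * dim τ b := by
  have hs : star (CFC.sqrt b) = CFC.sqrt b := (CFC.sqrt_nonneg b).isSelfAdjoint
  have hss := CFC.sqrt_mul_sqrt_self b hb
  have hy : star (CFC.sqrt b * x) * (CFC.sqrt b * x) = star x * b * x := by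
    rw [star_mul, hs, mul_assoc, ← mul_assoc (CFC.sqrt b), hss, ← mul_assoc]
  have hn : ‖CFC.sqrt b * x‖ ^ 2 = ‖star x * b * x‖ := by
    rw [sq, ← CStarRing.norm_star_mul_self, hy]
  refine τ.le_of_tendsto (l := atTop) (u := fun n => star (CFC.sqrt b * x) *
    cfcₙ (cutoff (dyadic n)) b * (CFC.sqrt b * x))
    (fun n => star_left_conjugate_nonneg (cfcₙ_cutoff_nonneg _ _) _) ?_ tendsto_const_nhds
    fun n => ?_
  · have hcomm (n : ℕ) : CFC.sqrt b * cfcₙ (cutoff (dyadic n)) b =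
        cfcₙ (cutoff (dyadic n)) b * CFC.sqrt b := by
      rw [CFC.sqrt_eq_real_sqrt b hb]
      exact cfcₙ_commute_cfcₙ _ _ b
    have := ((tendsto_cutoff_mul hb).const_mul (star x)).mul_const x
    refine this.congr fun n => ?_
    calc star x * (cfcₙ (cutoff (dyadic n)) b * b) * x
        = star x * (cfcₙ (cutoff (dyadic n)) b * CFC.sqrt b) * (CFC.sqrt b * x) := by
          rw [mul_assoc _ (_ * _) (_ * x), mul_assoc _ _ (_ * x), ← mul_assoc _ _ x, hss,
            mul_assoc, mul_assoc]
      _ = _ := by rw [← hcomm, star_mul, hs]; simp only [mul_assoc]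
  · calc _ ≤ ENNReal.ofReal (‖CFC.sqrt b * x‖ ^ 2) * τ (cfcₙ (cutoff (dyadic n)) b) :=
          τ.conj_le (cfcₙ_cutoff_nonneg _ _) _
      _ ≤ _ := by rw [hn]; gcongr; exact le_dim τ b (dyadic_mem n)

lemma CuntzLE.le_dim {a b : A} (h : CuntzLE a b) (ha : 0 ≤ a) (hb : 0 ≤ b) (τ : LscTrace A) :
    τ a ≤ ENNReal.ofReal ‖a‖ * dim τ b := by
  -- If `d_τ(b) = ∞`, the product with `‖x_n* b x_n‖` need not converge when the norms tend to 0, so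
  -- `a = 0` is separate.
  rcases eq_or_ne a 0 with rfl | h0
  · simp [τ.map_zero]
  obtain ⟨x, hx⟩ := h
  refine τ.le_of_tendsto (l := atTop) (fun n => star_left_conjugate_nonneg hb (x n)) hx
    (ENNReal.Tendsto.mul_const (ENNReal.tendsto_ofReal hx.norm) (Or.inl ?_))
    fun n => conj_le_dim τ hb (x n)
  simpa using h0

/-- Each `f_ε(a) = c a c` is again Cuntz below `b`, and has norm at most 1. -/
lemma CuntzLE.dim_le {a b : A} (h : CuntzLE a b) (ha : 0 ≤ a) (hb : 0 ≤ b) (τ : LscTrace A) :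
    dim τ a ≤ dim τ b := by
  refine iSup₂_le fun ε hε => ?_
  obtain ⟨c, hc0, hc, -⟩ := exists_cfcₙ_cutoff_eq ha hε.1
  have h' : CuntzLE (cfcₙ (cutoff ε) a) b := by
    obtain ⟨x, hx⟩ := h
    refine ⟨fun n => x n * c, ?_⟩
    rw [hc]
    refine ((hx.const_mul c).mul_const c).congr fun n => ?_
    simp only [star_mul, hc0.isSelfAdjoint.star_eq, mul_assoc]
  refine (h'.le_dim (cfcₙ_cutoff_nonneg ε a) hb τ).trans ?_
  calc _ ≤ 1 * dim τ b := by gcongr; exact ENNReal.ofReal_le_one.2 (norm_cfcₙ_cutoff_le ε a)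
    _ = _ := one_mul _


/-! ### Strictly positive elements and nested approximate units -/

lemma IsStrictlyPos.tendsto_cutoff_mul {a : A} (ha : IsStrictlyPos a) (x : A) :
    Tendsto (fun n => cfcₙ (cutoff (dyadic n)) a * x) atTop (𝓝 x) := by
  rw [Metric.tendsto_atTop]
  intro δ hδ
  obtain ⟨_, ⟨z, rfl⟩, hz⟩ := Metric.mem_closure_iff.1 (ha.2 x) (δ / 3) (by positivity)
  have h := ((ConScale.tendsto_cutoff_mul ha.1).mul_const z).mul_const a
  obtain ⟨N, hN⟩ := Metric.tendsto_atTop.1 h (δ / 3) (by positivity)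
  refine ⟨N, fun n hn => ?_⟩
  have h1 := hN n hn
  set f := cfcₙ (cutoff (dyadic n)) a
  have h2 : dist (f * x) (f * a * z * a) ≤ dist x (a * z * a) := by
    rw [dist_eq_norm, dist_eq_norm, mul_assoc f, mul_assoc f, ← mul_sub]
    exact (norm_mul_le _ _).trans
      (mul_le_of_le_one_left (norm_nonneg _) (norm_cfcₙ_cutoff_le _ a))
  have h3 := dist_triangle4 (f * x) (f * a * z * a) (a * z * a) x
  simp only at hz
  rw [dist_comm] at hz
  rw [dist_comm x] at h2
  linarith

lemma IsStrictlyPos.dim_eq_mass {a : A} (ha : IsStrictlyPos a) (τ : LscTrace A) :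
    dim τ a = τ.mass := by
  refine le_antisymm (dim_le_mass τ a) ?_
  rw [τ.mass_eq_iSup (u := fun n => cfcₙ (cutoff (dyadic n)) a)
    (fun n => cfcₙ_cutoff_nonneg _ a) (fun n => norm_cfcₙ_cutoff_le _ a) ha.tendsto_cutoff_mul]
  exact iSup_le fun n => le_dim τ a (dyadic_mem n)

/-- Nesting holds because `f_{δ/2}` is 1 wherever `f_δ` is nonzero. -/
lemma IsStrictlyPos.isNestedApproxUnit {a : A} (ha : IsStrictlyPos a) :
    IsNestedApproxUnit fun n => cfcₙ (cutoff (dyadic n)) a := by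
  have hmul (n : ℕ) : cfcₙ (cutoff (dyadic (n + 1))) a * cfcₙ (cutoff (dyadic n)) a =
      cfcₙ (cutoff (dyadic n)) a := by
    rw [← cfcₙ_mul _ _ a (continuous_cutoff _).continuousOn (cutoff_zero (dyadic_mem _).1)
      (continuous_cutoff _).continuousOn (cutoff_zero (dyadic_mem _).1)]
    exact cfcₙ_congr fun t _ => cutoff_mul_cutoff (dyadic_mem _).1 (dyadic_succ n).le
  have hsa (n : ℕ) : star (cfcₙ (cutoff (dyadic n)) a) = cfcₙ (cutoff (dyadic n)) a :=
    (cfcₙ_cutoff_nonneg _ a).isSelfAdjoint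
  refine ⟨fun n => cfcₙ_cutoff_nonneg _ a, fun n => norm_cfcₙ_cutoff_le _ a,
    monotone_nat_of_le_succ fun n => ?_, ha.tendsto_cutoff_mul, fun x => ?_, hmul, fun n => ?_⟩
  · exact cfcₙ_mono (fun t _ => cutoff_anti (dyadic_mem _).1
      (by rw [dyadic_succ]; linarith [(dyadic_mem n).1])) (continuous_cutoff _).continuousOn
      (continuous_cutoff _).continuousOn (cutoff_zero (dyadic_mem _).1)
      (cutoff_zero (dyadic_mem _).1)
  · have := (ha.tendsto_cutoff_mul (star x)).star
    simpa [hsa] using this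
  · simpa [hsa] using congrArg star (hmul n)

lemma IsNestedApproxUnit.mass_eq {e : ℕ → A} (he : IsNestedApproxUnit e) (τ : LscTrace A) :
    τ.mass = ⨆ n, τ (e n) :=
  τ.mass_eq_iSup he.nonneg he.norm_le he.tendsto_left

lemma IsNestedApproxUnit.mul_of_lt {e : ℕ → A} (he : IsNestedApproxUnit e) {m n : ℕ}
    (h : m < n) : e n * e m = e m := by
  induction n, h using Nat.le_induction with
  | base => exact he.succ_mul m
  | succ n _ ih => rw [← ih, ← mul_assoc, he.succ_mul]

/-- The element `e_{m+1} - e_n` acts as a unit on `e_m - e_{n+1}`. Widening the interval by one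
index at each end thus replaces a dimension by a trace value. -/
lemma IsNestedApproxUnit.dim_sub_add_le {e : ℕ → A} (he : IsNestedApproxUnit e) (τ : LscTrace A)
    {m n : ℕ} (h : n + 1 < m) : dim τ (e m - e (n + 1)) + τ (e n) ≤ τ (e (m + 1)) := by
  have h1 : 0 ≤ e (m + 1) - e n := sub_nonneg.2 (he.mono (by omega))
  have h2 : dim τ (e m - e (n + 1)) ≤ τ (e (m + 1) - e n) := by
    refine dim_le_of_mul_eq τ (sub_nonneg.2 (he.mono h.le)) h1 ?_
    · have hs {i j : ℕ} (hij : i < j) : e i * e j = e i := by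
        simpa [(he.nonneg _).isSelfAdjoint.star_eq] using congrArg star (he.mul_of_lt hij)
      rw [sub_mul, mul_sub, mul_sub, he.mul_of_lt (by omega), he.mul_of_lt (by omega),
        hs (by omega), hs (by omega), sub_self, sub_zero]
  calc _ ≤ τ (e (m + 1) - e n) + τ (e n) := by gcongr
    _ = τ (e (m + 1)) := by rw [← τ.map_add _ _ h1 (he.nonneg n), sub_add_cancel]

/-! ### The Pedersen ideal -/

/-- Here `w` plays the role of `(1 - z)⁻¹ - 1`, obtained without a unit as a fixed point. -/
lemma exists_quasiInverse {z : A} (hz : ‖z‖ < 1) : ∃ w, w = z + z * w := by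
  have hc : ContractingWith ‖z‖₊ fun w => z + z * w := by
    refine ⟨by exact_mod_cast hz, LipschitzWith.of_dist_le_mul fun v w => ?_⟩
    rw [dist_add_left, dist_eq_norm, dist_eq_norm, ← mul_sub]
    exact norm_mul_le _ _
  exact ⟨_, hc.fixedPoint_isFixedPt.symm⟩

/-- A dense ideal contains `y` with `‖e - y‖ < 1`. Since `x y = x (1 - (e - y))` and the last factor
is invertible, `x` is a right multiple of `x y`. Applied to `e_n`, this makes `τ ↦ τ(e_n)`
continuous. -/
lemma mem_ped_of_mul_eq {e x : A} (h : x * e = x) : x ∈ Ped A := by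
  intro I hI
  obtain ⟨y, hy, hey⟩ := Metric.mem_closure_iff.1 (hI e) 1 one_pos
  rw [dist_eq_norm] at hey
  obtain ⟨w, hw⟩ := exists_quasiInverse hey
  have hp : x * y ∈ I := I.mul_mem_left _ _ hy
  have hx : x = x * y + x * y * w := by
    have h1 : x * w = x * ((e - y) + (e - y) * w) := congrArg (x * ·) hw
    simp only [mul_add, mul_sub, sub_mul, ← mul_assoc, h] at h1
    have : x * y * w = x - x * y := by
      rw [eq_comm, ← sub_eq_zero]
      rw [← sub_eq_zero] at h1
      rw [← neg_eq_zero, ← h1]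
      abel
    rw [this]; abel
  rw [hx]
  exact I.add_mem hp (I.mul_mem_right _ _ hp)

lemma IsNestedApproxUnit.mem_ped {e : ℕ → A} (he : IsNestedApproxUnit e) (n : ℕ) :
    e n ∈ Ped A := mem_ped_of_mul_eq (he.mul_succ n)

lemma continuous_apply {b : A} (hb : 0 ≤ b) (hP : b ∈ Ped A) :
    Continuous fun τ : LscTrace A => τ b := by
  have h : Continuous fun (τ : LscTrace A) (b : {b : A // 0 ≤ b ∧ b ∈ Ped A}) => τ b :=
    continuous_induced_dom
  exact (_root_.continuous_apply (⟨b, hb, hP⟩ : {b : A // 0 ≤ b ∧ b ∈ Ped A})).comp h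

namespace LscTrace

variable (τ : LscTrace A)

/-- The parallelogram identity, with the term in `x - y` dropped. -/
lemma sq_add_le (x y : A) :
    τ (star (x + y) * (x + y)) ≤ 2 * (τ (star x * x) + τ (star y * y)) := by
  have h : star (x + y) * (x + y) + star (x - y) * (x - y) =
      (star x * x + star y * y) + (star x * x + star y * y) := by
    simp only [star_add, star_sub]; noncomm_ring
  have h1 : star (x + y) * (x + y) ≤ (star x * x + star y * y) + (star x * x + star y * y) :=
    h ▸ le_add_of_nonneg_right (star_mul_self_nonneg _)
  have hx := star_mul_self_nonneg x
  have hy := star_mul_self_nonneg y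
  refine (τ.mono (star_mul_self_nonneg _) h1).trans_eq ?_
  rw [τ.map_add _ _ (add_nonneg hx hy) (add_nonneg hx hy), τ.map_add _ _ hx hy, two_mul]

lemma sq_smul (c : ℂ) (x : A) :
    τ (star (c • x) * (c • x)) = ENNReal.ofReal (‖c‖ ^ 2) * τ (star x * x) := by
  rw [← τ.map_smul_real (sq_nonneg _) (star_mul_self_nonneg x), star_smul, smul_mul_smul_comm,
    RCLike.star_def, RCLike.conj_mul, ← Complex.coe_smul]
  norm_cast

lemma sq_mul_right_le (x y : A) :
    τ (star (x * y) * (x * y)) ≤ ENNReal.ofReal (‖y‖ ^ 2) * τ (star x * x) := by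
  have := τ.conj_le (star_mul_self_nonneg x) y
  simpa only [star_mul, mul_assoc] using this

lemma sq_mul_left_le (x y : A) :
    τ (star (x * y) * (x * y)) ≤ ENNReal.ofReal (‖x‖ ^ 2) * τ (star y * y) := by
  have := τ.sq_mul_right_le (star y) (star x)
  rwa [← star_mul, star_star, ← τ.map_star_mul, star_star, norm_star, ← τ.map_star_mul y] at this

/-- The two-sided ideal of all `x` with `τ (x* x)` in an ideal `S` of `[0, ∞]` that is stable under
multiplication by finite scalars. -/
def sqIdeal (S : Set ℝ≥0∞) (h0 : 0 ∈ S) (hadd : ∀ s ∈ S, ∀ t ∈ S, s + t ∈ S)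
    (hmul : ∀ (r : ℝ), ∀ s ∈ S, ∀ t ≤ ENNReal.ofReal r * s, t ∈ S) : TwoSidedIdeal A :=
  TwoSidedIdeal.mk' {x | τ (star x * x) ∈ S} (by simpa [τ.map_zero] using h0)
    (fun {x y} hx hy => hmul 2 _ (hadd _ hx _ hy) _ (by simpa using τ.sq_add_le x y))
    (fun {x} hx => by simpa using hx)
    (fun {x y} hy => hmul _ _ hy _ (τ.sq_mul_left_le x y))
    (fun {x y} hx => hmul _ _ hx _ (τ.sq_mul_right_le x y))

lemma mem_sqIdeal {S : Set ℝ≥0∞} {h0 hadd hmul} {x : A} :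
    x ∈ τ.sqIdeal S h0 hadd hmul ↔ τ (star x * x) ∈ S := by
  rw [sqIdeal, TwoSidedIdeal.mem_mk', mem_ofPred_eq]

/-- The ideal of all `x` with `τ (x* x) < ∞`. -/
def finiteIdeal : TwoSidedIdeal A :=
  τ.sqIdeal {t | t < ∞} ENNReal.zero_lt_top (fun _ hs _ ht => ENNReal.add_lt_top.2 ⟨hs, ht⟩)
    (fun _ _ hs _ ht => ht.trans_lt (ENNReal.mul_lt_top ENNReal.ofReal_lt_top hs))

lemma mem_finiteIdeal {x : A} : x ∈ τ.finiteIdeal ↔ τ (star x * x) < ∞ :=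
  τ.mem_sqIdeal

/-- The ideal of all `x` with `τ (x* x) = 0`. -/
def nullIdeal : TwoSidedIdeal A :=
  τ.sqIdeal {0} rfl (fun s hs t ht => by simp_all) (fun r s hs t ht => by simp_all)

lemma mem_nullIdeal {x : A} : x ∈ τ.nullIdeal ↔ τ (star x * x) = 0 :=
  τ.mem_sqIdeal

/-- If `τ(a) < ∞` then `a* a = √a a √a` has finite trace too. Such `a` are dense in `A₊`, which
spans `A`. -/
lemma dense_finiteIdeal : Dense (τ.finiteIdeal : Set A) := by
  -- A ring ideal of a non-unital algebra is not a priori a subspace, so scalar multiples are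
  -- checked.
  let S : Submodule ℂ A :=
    { carrier := τ.finiteIdeal
      zero_mem' := τ.finiteIdeal.zero_mem
      add_mem' := τ.finiteIdeal.add_mem
      smul_mem' := fun c x hx => by
        have hx' := τ.mem_finiteIdeal.1 hx
        refine τ.mem_finiteIdeal.2 ?_
        rw [τ.sq_smul]
        exact ENNReal.mul_lt_top ENNReal.ofReal_lt_top hx' }
  have h1 : {a : A | 0 ≤ a} ⊆ S.topologicalClosure := by
    refine τ.dense.trans (closure_mono fun a ⟨ha, hτ⟩ => τ.mem_finiteIdeal.2 ?_)
    have hs : star (CFC.sqrt a) = CFC.sqrt a := (CFC.sqrt_nonneg a).isSelfAdjoint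
    have hss := CFC.sqrt_mul_sqrt_self a ha
    have h2 : star a * a = star (CFC.sqrt a) * a * CFC.sqrt a := by
      rw [ha.isSelfAdjoint.star_eq, hs]
      conv_lhs => rw [← hss]
      conv_rhs => rw [← hss]
      rw [CFC.sqrt_mul_self _ (CFC.sqrt_nonneg a)]
      simp only [mul_assoc]
    rw [h2]
    exact (τ.conj_le ha _).trans_lt (ENNReal.mul_lt_top ENNReal.ofReal_lt_top hτ)
  have h2 : S.topologicalClosure = ⊤ := by
    rw [eq_top_iff, ← CStarAlgebra.span_nonneg]
    exact Submodule.span_le.2 h1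
  exact S.dense_iff_topologicalClosure_eq_top.2 h2

lemma sq_lt_top {x : A} (hx : x ∈ Ped A) : τ (star x * x) < ∞ :=
  τ.mem_finiteIdeal.1 (hx _ τ.dense_finiteIdeal)

end LscTrace

/-- The square of `e_{n+1}` has finite trace, by membership in the Pedersen ideal, and fixes `e_n`.
-/
lemma IsNestedApproxUnit.apply_lt_top {e : ℕ → A} (he : IsNestedApproxUnit e) (τ : LscTrace A)
    (n : ℕ) : τ (e n) < ∞ := by
  have h := τ.sq_lt_top (he.mem_ped (n + 1))
  refine (τ.le_of_mul_eq (star_mul_self_nonneg _) (he.nonneg n) (he.norm_le n) ?_).trans_lt h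
  rw [(he.nonneg _).isSelfAdjoint.star_eq, mul_assoc, he.succ_mul, he.succ_mul]

/-! ### Traces on algebraically simple algebras: finite, faithful, bounded -/

lemma ped_eq_univ [IsSimpleRing A] [Nontrivial A] : Ped A = univ := by
  refine eq_univ_of_forall fun x I hI => ?_
  rcases eq_bot_or_eq_top I with rfl | rfl
  · obtain ⟨y, hy⟩ := exists_ne (0 : A)
    have := hI y
    rw [TwoSidedIdeal.coe_bot, closure_singleton] at this
    exact (hy this).elim
  · trivial

namespace LscTrace

variable (τ : LscTrace A)

lemma lt_top_of_isSimpleRing [IsSimpleRing A] [Nontrivial A] {b : A} (hb : 0 ≤ b) : τ b < ∞ := by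
  have h := τ.sq_lt_top (x := CFC.sqrt b) (ped_eq_univ (A := A) ▸ mem_univ _)
  rwa [(CFC.sqrt_nonneg b).isSelfAdjoint.star_eq, CFC.sqrt_mul_sqrt_self b hb] at h

lemma ne_zero_of_isSimpleRing [IsSimpleRing A] (hτ : ∃ x, τ x ≠ 0) {b : A} (hb : 0 ≤ b)
    (hb0 : b ≠ 0) : τ b ≠ 0 := by
  intro h
  have hsq {a : A} (ha : 0 ≤ a) : star (CFC.sqrt a) * CFC.sqrt a = a := by
    rw [(CFC.sqrt_nonneg a).isSelfAdjoint.star_eq, CFC.sqrt_mul_sqrt_self a ha]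
  have hmem : CFC.sqrt b ∈ τ.nullIdeal := τ.mem_nullIdeal.2 (by rw [hsq hb, h])
  rcases eq_bot_or_eq_top τ.nullIdeal with h' | h'
  · rw [h', TwoSidedIdeal.mem_bot, CFC.sqrt_eq_zero_iff b hb] at hmem
    exact hb0 hmem
  · obtain ⟨x, hx⟩ := hτ
    -- The default value outside `A₊` is 0, so a nonzero value can only occur at a positive element.
    have hx0 : 0 ≤ x := by
      by_contra h0
      exact hx (τ.outside x h0)
    have : CFC.sqrt x ∈ τ.nullIdeal := h' ▸ TwoSidedIdeal.mem_top _
    rw [mem_nullIdeal, hsq hx0] at this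
    exact hx this

/-- Otherwise choose `b_n` in the positive unit ball with `τ(b_n) > 4^n`. Then `∑ 2^{-n} b_n` has
trace at least `2^n` for every `n`. -/
lemma mass_lt_top (h : ∀ b : A, 0 ≤ b → τ b < ∞) : τ.mass < ∞ := by
  by_contra! htop
  rw [top_le_iff] at htop
  have hex (n : ℕ) : ∃ b : A, 0 ≤ b ∧ ‖b‖ ≤ 1 ∧ ((4 ^ n : ℝ≥0) : ℝ≥0∞) < τ b := by
    have : ((4 ^ n : ℝ≥0) : ℝ≥0∞) < τ.mass := htop ▸ ENNReal.coe_lt_top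
    obtain ⟨⟨b, hb, hb1⟩, hlt⟩ := lt_iSup_iff.1 this
    exact ⟨b, hb, hb1, hlt⟩
  choose b hb0 hb1 hb using hex
  have hsum : Summable fun n => ((1 / 2 : ℝ) ^ n) • b n := by
    refine Summable.of_norm_bounded (summable_geometric_of_lt_one (by norm_num) one_half_lt_one)
      fun n => ?_
    rw [norm_smul, norm_pow, Real.norm_of_nonneg (by norm_num)]
    exact mul_le_of_le_one_right (by positivity) (hb1 n)
  have hpos (n : ℕ) : 0 ≤ ((1 / 2 : ℝ) ^ n) • b n := smul_nonneg (by positivity) (hb0 n)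
  have hfin := h (∑' n, ((1 / 2 : ℝ) ^ n) • b n) (tsum_nonneg hpos)
  obtain ⟨n, hn⟩ := ENNReal.exists_nat_gt hfin.ne
  refine hn.not_ge ?_
  calc (n : ℝ≥0∞) ≤ ((2 ^ n : ℝ≥0) : ℝ≥0∞) := by exact_mod_cast n.lt_two_pow_self.le
    _ = ENNReal.ofReal ((1 / 2 : ℝ) ^ n) * ((4 ^ n : ℝ≥0) : ℝ≥0∞) := by
      rw [ENNReal.ofReal, ← ENNReal.coe_mul, ENNReal.coe_inj]
      ext
      rw [NNReal.coe_mul, Real.coe_toNNReal _ (by positivity)]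
      push_cast
      rw [← mul_pow]; norm_num
    _ ≤ ENNReal.ofReal ((1 / 2 : ℝ) ^ n) * τ (b n) := by gcongr; exact (hb n).le
    _ = τ (((1 / 2 : ℝ) ^ n) • b n) := (τ.map_smul_real (by positivity) (hb0 n)).symm
    _ ≤ _ := τ.mono (hpos n) (hsum.le_tsum n fun m _ => hpos m)

end LscTrace

/-! ### Finite traces and positive linear functionals -/

namespace LscTrace

variable (τ : LscTrace A)

/-- A finite trace as a real-linear functional that depends only on the real part. -/
def reLinear (hτ : ∀ b : A, 0 ≤ b → τ b < ∞) : Module.Dual ℝ A :=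
  have hadd {p q : A} (hp : 0 ≤ p) (hq : 0 ≤ q) :
      (τ (p + q)).toReal = (τ p).toReal + (τ q).toReal := by
    rw [τ.map_add p q hp hq, ENNReal.toReal_add (hτ p hp).ne (hτ q hq).ne]
  -- The value is the same for every way of writing `x` as a difference of positive elements.
  -- Linearity follows by choosing convenient decompositions.
  have hwd {x p q p' q' : A} (hp : 0 ≤ p) (hq : 0 ≤ q) (hp' : 0 ≤ p') (hq' : 0 ≤ q')
      (h : x = p - q) (h' : x = p' - q') :
      (τ p).toReal - (τ q).toReal = (τ p').toReal - (τ q').toReal := by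
    have h1 : p + q' = p' + q := by
      rw [h, sub_eq_sub_iff_add_eq_add] at h'
      exact h'
    have := congrArg (fun y => (τ y).toReal) h1
    simp only [hadd hp hq', hadd hp' hq] at this
    linarith
  have hsmul {c : ℝ} (hc : 0 ≤ c) {p : A} (hp : 0 ≤ p) :
      (τ (c • p)).toReal = c * (τ p).toReal := by
    rw [τ.map_smul_real hc hp, ENNReal.toReal_mul, ENNReal.toReal_ofReal hc]
  have hdec (z : A) : (realPart z : A) = (realPart z : A)⁺ - (realPart z : A)⁻ :=
    (CFC.posPart_sub_negPart (realPart z : A) (realPart z).2).symm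
  have hp (z : A) := CFC.posPart_nonneg (realPart z : A)
  have hn (z : A) := CFC.negPart_nonneg (realPart z : A)
  { toFun := fun z => (τ (realPart z : A)⁺).toReal - (τ (realPart z : A)⁻).toReal
    map_add' := fun x y => by
      have h := hwd (hp _) (hn _) (add_nonneg (hp x) (hp y)) (add_nonneg (hn x) (hn y))
        (hdec (x + y)) (by
          rw [_root_.map_add, AddSubgroup.coe_add, add_sub_add_comm, ← hdec, ← hdec])
      rw [h, hadd (hp x) (hp y), hadd (hn x) (hn y)]
      ring
    map_smul' := fun c x => by
      have hre : (realPart (c • x) : A) = c • (realPart x : A)⁺ - c • (realPart x : A)⁻ := by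
        rw [← smul_sub, ← hdec, _root_.map_smul]
        rfl
      simp only [RingHom.id_apply, smul_eq_mul]
      rcases le_total 0 c with hc | hc
      · rw [hwd (hp _) (hn _) (smul_nonneg hc (hp x)) (smul_nonneg hc (hn x)) (hdec (c • x)) hre,
          hsmul hc (hp x), hsmul hc (hn x)]
        ring
      · have hc' : 0 ≤ -c := neg_nonneg.2 hc
        rw [hwd (hp _) (hn _) (smul_nonneg hc' (hn x)) (smul_nonneg hc' (hp x)) (hdec (c • x))
          (by rw [hre]; module), hsmul hc' (hp x), hsmul hc' (hn x)]
        ring }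

lemma reLinear_apply (hτ : ∀ b : A, 0 ≤ b → τ b < ∞) (z : A) :
    τ.reLinear hτ z = (τ (realPart z : A)⁺).toReal - (τ (realPart z : A)⁻).toReal := rfl

/-- A finite trace as a positive linear functional. -/
lemma exists_positiveLinearMap (hτ : ∀ b : A, 0 ≤ b → τ b < ∞) :
    ∃ φ : A →ₚ[ℂ] ℂ, ∀ a, 0 ≤ a → φ a = ((τ a).toReal : ℂ) := by
  have key (a : A) (ha : 0 ≤ a) :
      (τ.reLinear hτ).extendRCLike (𝕜 := ℂ) a = ((τ a).toReal : ℂ) := by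
    have h1 : τ.reLinear hτ a = (τ a).toReal := by
      rw [reLinear_apply, ha.isSelfAdjoint.coe_realPart, (CFC.posPart_eq_self a).2 ha,
        (CFC.negPart_eq_zero_iff a ha.isSelfAdjoint).2 ha]
      simp [τ.map_zero]
    have h2 : τ.reLinear hτ ((RCLike.I : ℂ) • a) = 0 := by
      have : realPart ((RCLike.I : ℂ) • a) = 0 := by
        rw [RCLike.I_to_complex, realPart_I_smul, ha.isSelfAdjoint.imaginaryPart, neg_zero]
      rw [reLinear_apply, this]; simp [τ.map_zero]
    rw [Module.Dual.extendRCLike_apply, h1, h2]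
    simp
  refine ⟨PositiveLinearMap.mk₀ ((τ.reLinear hτ).extendRCLike (𝕜 := ℂ)) fun a ha => ?_, key⟩
  rw [key a ha]
  exact_mod_cast ENNReal.toReal_nonneg

end LscTrace

/-- Polarization: the polarized identity is used at `(x*, y)` and at `(i x*, y)`. -/
lemma map_mul_comm_of_star_mul {φ : A →ₗ[ℂ] ℂ} (h : ∀ x, φ (star x * x) = φ (x * star x))
    (x y : A) : φ (x * y) = φ (y * x) := by
  have hadd (x y : A) : φ (star x * y) + φ (star y * x) = φ (x * star y) + φ (y * star x) := by
    have := h (x + y)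
    simp only [star_add, add_mul, mul_add, map_add, h x, h y] at this
    linear_combination this
  have h1 := hadd (star x) y
  have h2 := hadd (Complex.I • star x) y
  simp only [star_smul, star_star, smul_mul_assoc, mul_smul_comm, map_smul, smul_eq_mul,
    RCLike.star_def, Complex.conj_I] at h1 h2
  have hI := Complex.I_mul_I
  linear_combination (1 / 2 : ℂ) * h1 + (Complex.I / 2) * h2 + (1 / 2 : ℂ) * (φ (x * y) - φ (y * x)
    - φ (star y * star x) + φ (star x * star y)) * hI

/-- Cauchy–Schwarz in the GNS space gives `|φ(e_n x)|² ≤ φ(e_n e_n*) φ(x* x) ≤ s · s‖x‖²`. Let `n →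
∞`. -/
lemma norm_le_of_approxUnit {e : ℕ → A} (he : IsNestedApproxUnit e) {φ : A →L[ℂ] ℂ}
    (hφ : ∀ a, 0 ≤ a → 0 ≤ φ a) {s : ℝ} (hs : 0 ≤ s)
    (h : ∀ a, 0 ≤ a → ‖a‖ ≤ 1 → (φ a).re ≤ s) : ‖φ‖ ≤ s := by
  let ψ : A →ₚ[ℂ] ℂ := PositiveLinearMap.mk₀ (φ : A →ₗ[ℂ] ℂ) hφ
  have hψ (a : A) : ψ a = φ a := rfl
  have hle (a : A) (ha : 0 ≤ a) : (φ a).re ≤ s * ‖a‖ := by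
    rcases eq_or_ne a 0 with rfl | h0
    · simp
    have hpos : 0 < ‖a‖ := norm_pos_iff.2 h0
    have h1 := h (‖a‖⁻¹ • a) (smul_nonneg (by positivity) ha)
      (by rw [norm_smul, norm_inv, norm_norm, inv_mul_cancel₀ hpos.ne'])
    rw [← Complex.coe_smul, map_smul, smul_eq_mul, Complex.re_ofReal_mul,
      inv_mul_le_iff₀ hpos] at h1
    linarith
  refine φ.opNorm_le_bound hs fun x => ?_
  refine le_of_tendsto ((φ.continuous.tendsto _).comp (he.tendsto_left x)).norm
    (.of_forall fun n => ?_)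
  have h1 := norm_inner_le_norm (𝕜 := ℂ) (ψ.toPreGNS (star (e n))) (ψ.toPreGNS x)
  rw [PositiveLinearMap.preGNS_inner_def, PositiveLinearMap.preGNS_norm_def,
    PositiveLinearMap.preGNS_norm_def] at h1
  simp only [PositiveLinearMap.ofPreGNS_toPreGNS, star_star, hψ] at h1
  refine h1.trans ?_
  have h2 : (φ (e n * star (e n))).re ≤ s := by
    refine h _ (mul_star_self_nonneg _) ?_
    rw [CStarRing.norm_self_mul_star]
    exact mul_le_one₀ (he.norm_le n) (norm_nonneg _) (he.norm_le n)
  have h3 : (φ (star x * x)).re ≤ s * ‖x‖ ^ 2 := by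
    have := hle _ (star_mul_self_nonneg x)
    rwa [CStarRing.norm_star_mul_self, ← sq] at this
  calc _ ≤ √s * √(s * ‖x‖ ^ 2) := by gcongr
    _ = s * ‖x‖ := by
      rw [Real.sqrt_mul hs, Real.sqrt_sq (norm_nonneg x), ← mul_assoc, Real.mul_self_sqrt hs]

lemma mem_tracialStates_iff (hσ : IsSigmaUnital A) {τ : LscTrace A} :
    τ ∈ tracialStates A ↔ τ.mass = 1 := by
  obtain ⟨a, ha⟩ := hσ
  have he := ha.isNestedApproxUnit
  have hle {φ : A →L[ℂ] ℂ} {b : A} : (φ b).re ≤ ‖φ‖ * ‖b‖ :=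
    (Complex.re_le_norm _).trans (φ.le_opNorm b)
  constructor
  · rintro ⟨φ, hφ, hn, -, hτ⟩
    have h1 : τ.mass ≤ 1 := iSup_le fun ⟨b, hb, hb1⟩ => by
      rw [hτ b hb, ENNReal.ofReal_le_one]
      exact hle.trans (by rwa [hn, one_mul])
    refine h1.antisymm ?_
    have h2 : ‖φ‖ ≤ τ.mass.toReal := by
      refine norm_le_of_approxUnit he hφ ENNReal.toReal_nonneg fun b hb hb1 => ?_
      have := ENNReal.toReal_mono (h1.trans_lt ENNReal.one_lt_top).ne (τ.le_mass hb hb1)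
      rwa [hτ b hb, ENNReal.toReal_ofReal (Complex.nonneg_iff.1 (hφ b hb)).1] at this
    rw [hn, ← ENNReal.ofReal_le_iff_le_toReal (h1.trans_lt ENNReal.one_lt_top).ne] at h2
    simpa using h2
  · intro hm
    have hfin (b : A) (hb : 0 ≤ b) : τ b < ∞ :=
      (τ.le_norm_mul_mass hb).trans_lt (by simp [hm])
    obtain ⟨ψ, hψ⟩ := τ.exists_positiveLinearMap hfin
    let φ : A →L[ℂ] ℂ := ⟨ψ.toLinearMap, map_continuous ψ⟩
    have hφ (b : A) : φ b = ψ b := rfl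
    have hpos (b : A) (hb : 0 ≤ b) : 0 ≤ φ b := ψ.map_nonneg hb
    have hτ (b : A) (hb : 0 ≤ b) : τ b = ENNReal.ofReal (φ b).re := by
      rw [hφ, hψ b hb, Complex.ofReal_re, ENNReal.ofReal_toReal (hfin b hb).ne]
    refine ⟨φ, hpos, le_antisymm ?_ ?_, fun x y => ?_, hτ⟩
    · refine norm_le_of_approxUnit he hpos zero_le_one fun b hb hb1 => ?_
      rw [← ENNReal.ofReal_le_one, ← hτ b hb, ← hm]
      exact τ.le_mass hb hb1
    · rw [← ENNReal.one_le_ofReal, ← hm]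
      refine iSup_le fun ⟨b, hb, hb1⟩ => ?_
      rw [hτ b hb]
      exact ENNReal.ofReal_le_ofReal (hle.trans (mul_le_of_le_one_right (norm_nonneg _) hb1))
    · refine map_mul_comm_of_star_mul (φ := (φ : A →ₗ[ℂ] ℂ)) (fun z => ?_) x y
      change ψ _ = ψ _
      rw [hψ _ (star_mul_self_nonneg z), hψ _ (mul_star_self_nonneg z), τ.map_star_mul]

/-! ### Compactness -/

/-- From `a ≤ b + (a - b)⁺`. This Lipschitz bound survives pointwise limits, whereas lower
semicontinuity alone would not. -/
lemma LscTrace.apply_le_add (τ : LscTrace A) (hτ : τ.mass ≤ 1) {a b : A} (ha : 0 ≤ a)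
    (hb : 0 ≤ b) : τ a ≤ τ b + ENNReal.ofReal ‖a - b‖ := by
  have hsa : IsSelfAdjoint (a - b) := ha.isSelfAdjoint.sub hb.isSelfAdjoint
  have hp := CFC.posPart_nonneg (a - b)
  have h1 : a ≤ b + (a - b)⁺ := sub_le_iff_le_add'.1 (CFC.le_posPart hsa)
  refine (τ.mono ha h1).trans ?_
  rw [τ.map_add _ _ hb hp]
  gcongr
  calc _ ≤ ENNReal.ofReal ‖(a - b)⁺‖ * τ.mass := τ.le_norm_mul_mass hp
    _ ≤ ENNReal.ofReal ‖a - b‖ * 1 := by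
      gcongr
      exact CStarAlgebra.norm_posPart_le (a - b)
    _ = _ := mul_one _

/-- Along an ultrafilter the values converge in `[0, ∞]` at every point of `A`. The algebraic
identities pass to the limit, and the Lipschitz bound makes the limit lower semicontinuous. -/
lemma isCompact_mass_le_one : IsCompact {τ : LscTrace A | τ.mass ≤ 1} := by
  rw [isCompact_iff_ultrafilter_le_nhds]
  intro U hU
  rw [le_principal_iff] at hU
  have hex (a : A) : ∃ t, Tendsto (fun τ : LscTrace A => τ a) U (𝓝 t) := by
    obtain ⟨t, -, ht⟩ := isCompact_univ.ultrafilter_le_nhds (U.map fun τ : LscTrace A => τ a)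
      (by simp)
    exact ⟨t, ht⟩
  choose T hT using hex
  have hle (b : A) (hb : 0 ≤ b) (hb1 : ‖b‖ ≤ 1) : T b ≤ 1 :=
    le_of_tendsto (hT b) (mem_of_superset hU fun τ hτ => (τ.le_mass hb hb1).trans hτ)
  have hadd (a b : A) (ha : 0 ≤ a) (hb : 0 ≤ b) : T a ≤ T b + ENNReal.ofReal ‖a - b‖ :=
    le_of_tendsto_of_tendsto (hT a) ((hT b).add_const _)
      (mem_of_superset hU fun τ hτ => τ.apply_le_add hτ ha hb)
  have h0 : T 0 = 0 := tendsto_nhds_unique (hT 0) (by simp [LscTrace.map_zero])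
  have hfin (a : A) (ha : 0 ≤ a) : T a < ∞ :=
    (hadd a 0 ha le_rfl).trans_lt (by simp [h0])
  let τ₀ : LscTrace A :=
    { toFun := T
      map_add := fun a b ha hb => tendsto_nhds_unique (hT (a + b))
        (((hT a).add (hT b)).congr fun τ => (τ.map_add a b ha hb).symm)
      map_smul := fun c a ha => tendsto_nhds_unique (hT _)
        ((ENNReal.Tendsto.const_mul (hT a) (Or.inr ENNReal.coe_ne_top)).congr
          fun τ => (τ.map_smul c a ha).symm)
      map_star_mul := fun x => tendsto_nhds_unique (hT _)
        ((hT _).congr fun τ => (τ.map_star_mul x).symm)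
      lsc := fun a ha y hy => by
        have h1 : Tendsto (fun b => T a - ENNReal.ofReal ‖a - b‖) (𝓝[{a | 0 ≤ a}] a)
            (𝓝 (T a - ENNReal.ofReal ‖a - a‖)) := by
          refine tendsto_nhdsWithin_of_tendsto_nhds ?_
          refine ENNReal.Tendsto.sub tendsto_const_nhds ?_ (Or.inl (hfin a ha).ne)
          have : Continuous fun b : A => ENNReal.ofReal ‖a - b‖ :=
            ENNReal.continuous_ofReal.comp (by fun_prop)
          exact this.tendsto a
        rw [sub_self, norm_zero, ENNReal.ofReal_zero, tsub_zero] at h1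
        filter_upwards [h1.eventually (lt_mem_nhds hy), self_mem_nhdsWithin] with b hb hb0
        exact hb.trans_le (tsub_le_iff_right.2 (hadd a b ha hb0))
      dense := fun a ha => subset_closure ⟨ha, hfin a ha⟩
      outside := fun a ha => tendsto_nhds_unique (hT a)
        (by simp only [LscTrace.outside _ a ha, tendsto_const_nhds]) }
  refine ⟨τ₀, show τ₀.mass ≤ 1 from iSup_le fun ⟨b, hb, hb1⟩ => hle b hb hb1, ?_⟩
  have : Tendsto id (U : Filter (LscTrace A)) (𝓝 τ₀) := by
    rw [nhds_induced, tendsto_comap_iff, tendsto_pi_nhds]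
    exact fun b => hT b
  exact this

/-! ### Algebras with continuous scale -/

/-- Given `b` for `k`, a nonzero tail beyond `N` and `L` is Cuntz below `b`, so `k` times its
dimension is at most `τ(e_L)`. Being disjoint from the earlier part of the approximate unit, it
leaves room for one more copy. -/
lemma exists_mul_dim_le {e : ℕ → A} (he : IsNestedApproxUnit e)
    (hs : ∀ b : A, 0 ≤ b → b ≠ 0 → ∃ N : ℕ, ∀ m n : ℕ, N ≤ n → n < m → CuntzLE (e m - e n) b)
    (hne : ∀ n, ∃ m > n, e m ≠ e n) (k : ℕ) :
    ∃ b : A, 0 ≤ b ∧ b ≠ 0 ∧ ∃ L, ∀ τ : LscTrace A, k * dim τ b ≤ τ (e L) := by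
  induction k with
  | zero =>
    obtain ⟨m, hm, hm0⟩ := hne 0
    exact ⟨e m - e 0, sub_nonneg.2 (he.mono hm.le), sub_ne_zero.2 hm0, 0, fun τ => by simp⟩
  | succ k ih =>
    obtain ⟨b, hb, hb0, L, hL⟩ := ih
    obtain ⟨N, hN⟩ := hs b hb hb0
    -- The `+ 1` is the index given up in `dim_sub_add_le`.
    obtain ⟨m, hm, hm0⟩ := hne (max N L + 1)
    have hpos : 0 ≤ e m - e (max N L + 1) := sub_nonneg.2 (he.mono (le_of_lt hm))
    refine ⟨e m - e (max N L + 1), hpos, sub_ne_zero.2 hm0, m + 1, fun τ => ?_⟩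
    have h1 := (hN m (max N L + 1) (by omega) hm).dim_le hpos hb τ
    calc _ = dim τ (e m - e (max N L + 1)) + k * dim τ (e m - e (max N L + 1)) := by
          push_cast; ring
      _ ≤ dim τ (e m - e (max N L + 1)) + τ (e (max N L)) := by
        gcongr
        calc _ ≤ k * dim τ b := by gcongr
          _ ≤ τ (e L) := hL τ
          _ ≤ _ := τ.mono (he.nonneg L) (he.mono (le_max_right N L))
      _ ≤ _ := he.dim_sub_add_le τ hm

lemma exists_mul_mass_le {e : ℕ → A} (he : IsNestedApproxUnit e)
    (hs : ∀ b : A, 0 ≤ b → b ≠ 0 → ∃ N : ℕ, ∀ m n : ℕ, N ≤ n → n < m → CuntzLE (e m - e n) b)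
    (k : ℕ) : ∃ N L, ∀ τ : LscTrace A, k * τ.mass ≤ k * τ (e N) + τ (e L) := by
  by_cases hne : ∀ n, ∃ m > n, e m ≠ e n
  · obtain ⟨b, hb, hb0, L, hL⟩ := exists_mul_dim_le he hs hne k
    obtain ⟨N, hN⟩ := hs b hb hb0
    refine ⟨N, L, fun τ => ?_⟩
    rw [he.mass_eq, ENNReal.mul_iSup]
    refine iSup_le fun m => ?_
    rcases le_or_gt m N with hm | hm
    · refine le_trans ?_ le_self_add
      gcongr
      exact τ.mono (he.nonneg m) (he.mono hm)
    · have hpos : 0 ≤ e m - e N := sub_nonneg.2 (he.mono hm.le)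
      have h1 : τ (e m - e N) ≤ dim τ b := by
        refine ((hN m N le_rfl hm).le_dim hpos hb τ).trans (mul_le_of_le_one_left' ?_)
        refine ENNReal.ofReal_le_one.2 ?_
        exact (CStarAlgebra.norm_le_norm_of_nonneg_of_le hpos
          (sub_le_self _ (he.nonneg N))).trans (he.norm_le m)
      calc k * τ (e m) = k * τ (e N) + k * τ (e m - e N) := by
            rw [← mul_add, ← τ.map_add _ _ (he.nonneg N) hpos, add_sub_cancel]
        _ ≤ k * τ (e N) + k * dim τ b := by gcongr
        _ ≤ _ := by gcongr; exact hL τ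
  -- Now the approximate unit is eventually constant, and the mass is attained at its final value.
  · push Not at hne
    obtain ⟨n, hn⟩ := hne
    refine ⟨n, n, fun τ => le_trans ?_ le_self_add⟩
    gcongr
    rw [he.mass_eq]
    refine iSup_le fun m => τ.mono (he.nonneg m) ?_
    rcases le_or_gt m n with hm | hm
    · exact he.mono hm
    · exact (hn m hm).le

lemma HasContinuousScale.continuous_mass (h : HasContinuousScale A) :
    Continuous (LscTrace.mass : LscTrace A → ℝ≥0∞) := by
  obtain ⟨e, he, hs⟩ := h
  have hcont (n : ℕ) : Continuous fun τ : LscTrace A => τ (e n) :=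
    continuous_apply (he.nonneg n) (he.mem_ped n)
  have hle (τ : LscTrace A) (n : ℕ) : τ (e n) ≤ τ.mass := τ.le_mass (he.nonneg n) (he.norm_le n)
  have hfin (τ : LscTrace A) : τ.mass ≠ ∞ := by
    obtain ⟨N, L, h1⟩ := exists_mul_mass_le he hs 1
    have := h1 τ
    simp only [Nat.cast_one, one_mul] at this
    exact (this.trans_lt (ENNReal.add_lt_top.2 ⟨he.apply_lt_top τ N, he.apply_lt_top τ L⟩)).ne
  rw [continuous_iff_lower_upperSemicontinuous]
  constructor
  · have : (LscTrace.mass : LscTrace A → ℝ≥0∞) = fun τ => ⨆ n, τ (e n) :=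
      funext fun τ => he.mass_eq τ
    rw [this]
    exact lowerSemicontinuous_iSup fun n => (hcont n).lowerSemicontinuous
  · intro τ₀ y hy
    obtain ⟨z, hz, hzy⟩ := ENNReal.lt_iff_exists_nnreal_btwn.1 hy
    lift τ₀.mass to ℝ≥0 using hfin τ₀ with M hM
    have hMz : (M : ℝ) < z := by exact_mod_cast hz
    -- This is the condition `(k + 1) M < k z`.
    obtain ⟨k, hk⟩ := exists_nat_gt ((M : ℝ) / (z - M))
    have hk0 : (0 : ℝ) < k := (div_nonneg M.2 (sub_pos.2 hMz).le).trans_lt hk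
    rw [div_lt_iff₀ (sub_pos.2 hMz)] at hk
    have hkM : ((k + 1 : ℕ) : ℝ≥0∞) * M < k * z := by
      have : ((k + 1 : ℕ) : ℝ≥0) * M < k * z := by
        rw [← NNReal.coe_lt_coe]
        push_cast
        linarith
      exact_mod_cast this
    obtain ⟨N, L, hNL⟩ := exists_mul_mass_le he hs (k + 1)
    have hlt : ((k + 1 : ℕ) : ℝ≥0∞) * τ₀ (e N) < k * z := by
      refine lt_of_le_of_lt ?_ hkM
      gcongr
      exact hM ▸ hle τ₀ N
    have hc : Continuous fun τ : LscTrace A => ((k + 1 : ℕ) : ℝ≥0∞) * τ (e N) :=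
      (ENNReal.continuous_const_mul (ENNReal.natCast_ne_top _)).comp (hcont N)
    filter_upwards [(hc.tendsto τ₀).eventually (gt_mem_nhds hlt)] with τ hτ
    -- In the estimate for `k + 1`, bound `τ(e_L)` by the mass and cancel one copy of it, which is
    -- finite.
    have h1 : (k : ℝ≥0∞) * τ.mass ≤ ((k + 1 : ℕ) : ℝ≥0∞) * τ (e N) := by
      have h2 := (hNL τ).trans (add_le_add_right (hle τ L) _)
      rw [Nat.cast_add, Nat.cast_one, add_mul, one_mul, ENNReal.add_le_add_iff_right (hfin τ)] at h2
      exact_mod_cast h2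
    have h2 := h1.trans_lt hτ
    refine lt_trans ?_ hzy
    by_contra! hge
    exact h2.not_ge (by gcongr)

lemma isCompact_tracialStates_of_mass (hσ : IsSigmaUnital A)
    (h : ∀ τ ∈ closure (tracialStates A), τ.mass = 1) : IsCompact (tracialStates A) := by
  have hcl : IsClosed (tracialStates A) :=
    isClosed_of_closure_subset fun τ hτ => (mem_tracialStates_iff hσ).2 (h τ hτ)
  exact isCompact_mass_le_one.of_isClosed_subset hcl fun τ hτ =>
    ((mem_tracialStates_iff hσ).1 hτ).le

lemma isCompact_tracialStates_of_continuousOn (hσ : IsSigmaUnital A)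
    (h : ContinuousOn (LscTrace.mass : LscTrace A → ℝ≥0∞) (closure (tracialStates A))) :
    IsCompact (tracialStates A) := by
  refine isCompact_tracialStates_of_mass hσ fun τ hτ => ?_
  have h1 : MapsTo (LscTrace.mass : LscTrace A → ℝ≥0∞) (tracialStates A) {1} :=
    fun τ hτ => (mem_tracialStates_iff hσ).1 hτ
  have := h1.closure_of_continuousOn h hτ
  rwa [closure_singleton] at this

/-! ### Comparison in the corner `A ⊗ e₀₀` -/

namespace FinMat

/-- The matrix with `a` in position `(0, 0)` and zeros elsewhere. -/
def single (a : A) : FinMat A :=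
  ⟨fun i j => if i = 0 ∧ j = 0 then a else 0, 1, fun i j h => if_neg (by omega)⟩

lemma entry_single (a : A) (i j : ℕ) :
    (single a).entry i j = if i = 0 ∧ j = 0 then a else 0 := rfl

lemma entry_single_mul (x : FinMat A) (a : A) (j : ℕ) :
    (single a * x).entry 0 j = a * x.entry 0 j := by
  rw [entry_mul, finsum_eq_single _ 0 fun k hk => by simp [entry_single, hk]]
  simp [entry_single]

lemma entry_single_mul_of_ne (x : FinMat A) (a : A) {i : ℕ} (hi : i ≠ 0) (j : ℕ) :
    (single a * x).entry i j = 0 := by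
  rw [entry_mul, finsum_eq_single _ 0 fun k hk => by simp [entry_single, hk]]
  simp [entry_single, hi]

end FinMat

namespace Stab

/-- The embedding `a ↦ a ⊗ e₀₀` of `A` into `A ⊗ 𝒦`. -/
def single : A →⋆ₙₐ[ℂ] Stab A where
  toFun a := of (FinMat.single a)
  map_smul' c a := by
    rw [MonoidHom.id_apply, ← of_smul]
    congr 1
    ext i j
    simp only [FinMat.entry_single, FinMat.entry_smul, smul_ite, smul_zero]
  map_zero' := by
    rw [← of_zero]
    congr 1
    ext i j
    simp [FinMat.entry_single]
  map_add' a b := by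
    rw [← of_add]
    congr 1
    ext i j
    simp only [FinMat.entry_single, FinMat.entry_add]
    split_ifs <;> simp
  map_mul' a b := by
    rw [← of_mul]
    congr 1
    ext i j
    by_cases hi : i = 0
    · subst hi
      rw [FinMat.entry_single_mul, FinMat.entry_single, FinMat.entry_single]
      simp
    · rw [FinMat.entry_single_mul_of_ne _ _ hi, FinMat.entry_single, if_neg (by simp [hi])]
  map_star' a := by
    rw [← of_star]
    congr 1
    ext i j
    simp only [FinMat.entry_single, FinMat.entry_star, and_comm]
    split_ifs <;> simp

lemma entry_single (a : A) (i j : ℕ) :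
    entry i j (single a) = if i = 0 ∧ j = 0 then a else 0 :=
  entry_of i j (FinMat.single a)

lemma continuous_single : Continuous (single : A → Stab A) :=
  AddMonoidHomClass.continuous_of_bound single 1 fun a => by
    simpa only [one_mul] using NonUnitalStarAlgHom.norm_apply_le single a

lemma entry_star_mul_single_mul (x : Stab A) (b : A) :
    entry 0 0 (star x * single b * x) = star (entry 0 0 x) * b * entry 0 0 x := by
  refine induction₁ x (isClosed_eq ?_ ?_) fun x => ?_
  · exact (continuous_entry 0 0).comp (by fun_prop)
  · have := continuous_entry (A := A) 0 0
    fun_prop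
  · change entry 0 0 (star (of x) * of (FinMat.single b) * of x) = _
    rw [← of_star, mul_assoc, ← of_mul, ← of_mul, entry_of, entry_of]
    rw [FinMat.entry_mul, finsum_eq_single _ 0 fun k hk => by
      rw [FinMat.entry_single_mul_of_ne _ _ hk, mul_zero], FinMat.entry_single_mul,
      FinMat.entry_star, mul_assoc]

end Stab

/-- The `(0, 0)` entries of the witnesses in `A ⊗ 𝒦` are witnesses in `A`. -/
lemma cuntzLE_of_single {a b : A} (h : CuntzLE (Stab.single a) (Stab.single b)) : CuntzLE a b := by
  obtain ⟨x, hx⟩ := h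
  refine ⟨fun n => Stab.entry 0 0 (x n), ?_⟩
  have := ((Stab.continuous_entry 0 0).tendsto _).comp hx
  simpa only [Function.comp_def, Stab.entry_star_mul_single_mul, Stab.entry_single, and_self,
    if_true] using this

lemma stabTrace_single (τ : LscTrace A) (a : A) : stabTrace τ (Stab.single a) = τ a := by
  rw [stabTrace, tsum_eq_single 0 fun i hi => by
    rw [Stab.entry_single, if_neg (by simp [hi]), τ.map_zero], Stab.entry_single]
  simp

lemma stabDim_single (τ : LscTrace A) {a : A} (ha : IsSelfAdjoint a) :
    stabDim τ (Stab.single a) = dim τ a := by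
  unfold stabDim dim
  refine iSup_congr fun ε => iSup_congr fun hε => ?_
  rw [← stabTrace_single, NonUnitalStarAlgHomClass.map_cfcₙ Stab.single (cutoff ε) a
    (continuous_cutoff ε).continuousOn (cutoff_zero hε.1) Stab.continuous_single]

/-- In place of a unit, `f_ε(a)` with `ε → 0` serves as witness. With `CuntzLE.le_dim` this yields
`τ(a) ≤ ‖a‖ d_τ(a)`. -/
lemma cuntzLE_refl {a : A} (ha : 0 ≤ a) : CuntzLE a a := by
  have hsa (n : ℕ) : star (cfcₙ (cutoff (dyadic n)) a) = cfcₙ (cutoff (dyadic n)) a :=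
    (cfcₙ_cutoff_nonneg _ a).isSelfAdjoint
  refine ⟨fun n => cfcₙ (cutoff (dyadic n)) a, ?_⟩
  have h1 := tendsto_cutoff_mul ha
  have h2 : Tendsto (fun n => a * cfcₙ (cutoff (dyadic n)) a) atTop (𝓝 a) := by
    simpa only [star_mul, hsa, ha.isSelfAdjoint.star_eq] using h1.star
  have h3 : Tendsto (fun n => (cfcₙ (cutoff (dyadic n)) a * a - a) * cfcₙ (cutoff (dyadic n)) a)
      atTop (𝓝 0) := by
    refine squeeze_zero_norm (fun n => ?_) (tendsto_iff_norm_sub_tendsto_zero.1 h1)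
    exact (norm_mul_le _ _).trans
      (mul_le_of_le_one_right (norm_nonneg _) (norm_cfcₙ_cutoff_le _ a))
  have h4 := h3.add h2
  rw [zero_add] at h4
  exact h4.congr fun n => by rw [hsa, sub_mul, sub_add_cancel]

/-! ### Comparison on normalized traces -/

/-- A positive multiple of a trace. -/
def LscTrace.scale (τ : LscTrace A) (c : ℝ≥0) : LscTrace A where
  toFun a := c * τ a
  map_add a b ha hb := by rw [τ.map_add a b ha hb, mul_add]
  map_smul r a ha := by rw [τ.map_smul r a ha, mul_left_comm]
  map_star_mul x := by rw [τ.map_star_mul]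
  lsc := (ENNReal.continuous_const_mul ENNReal.coe_ne_top).comp_lowerSemicontinuousOn τ.lsc
    fun _ _ h => by dsimp only; gcongr
  dense := τ.dense.trans (closure_mono fun _ ⟨ha, h⟩ =>
    ⟨ha, ENNReal.mul_lt_top ENNReal.coe_lt_top h⟩)
  outside a ha := by rw [τ.outside a ha, mul_zero]

lemma LscTrace.scale_apply (τ : LscTrace A) (c : ℝ≥0) (a : A) : τ.scale c a = c * τ a := rfl

lemma LscTrace.mass_scale (τ : LscTrace A) (c : ℝ≥0) : (τ.scale c).mass = c * τ.mass := by
  simp only [mass, scale_apply, ENNReal.mul_iSup]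

lemma dim_scale (τ : LscTrace A) (c : ℝ≥0) (a : A) : dim (τ.scale c) a = c * dim τ a := by
  simp only [dim, LscTrace.scale_apply, ENNReal.mul_iSup]

/-- A nonzero trace has finite nonzero mass here, so it is a multiple of a tracial state, and the
strict inequality is invariant under scaling. -/
lemma cuntzLE_of_dim_lt [IsSimpleRing A] [Nontrivial A] (hσ : IsSigmaUnital A)
    (hsc : HasStrictComparison A) {a b : A} (ha : 0 ≤ a) (hb : 0 ≤ b) (hb0 : b ≠ 0)
    (h : ∀ τ ∈ tracialStates A, dim τ a < dim τ b) : CuntzLE a b := by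
  have hpos {c : A} (hc : 0 ≤ c) : 0 ≤ Stab.single c := by
    have := star_mul_self_nonneg (Stab.single (CFC.sqrt c))
    rwa [← map_star, ← map_mul, (CFC.sqrt_nonneg c).isSelfAdjoint.star_eq,
      CFC.sqrt_mul_sqrt_self c hc] at this
  refine cuntzLE_of_single (hsc _ _ (hpos ha) (hpos hb) (fun h0 => hb0 ?_) fun τ hτ => ?_)
  · have := Stab.entry_single b 0 0
    rw [h0, ← map_zero Stab.single, Stab.entry_single] at this
    simpa using this.symm
  rw [stabDim_single τ ha.isSelfAdjoint, stabDim_single τ hb.isSelfAdjoint]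
  have hfin : τ.mass < ∞ := τ.mass_lt_top fun c hc => τ.lt_top_of_isSimpleRing hc
  have hne : τ.mass ≠ 0 := by
    intro h0
    obtain ⟨x, hx⟩ := hτ
    refine hx ?_
    by_cases hx0 : 0 ≤ x
    · simpa [h0] using τ.le_norm_mul_mass hx0
    · exact τ.outside x hx0
  refine ⟨?_, (dim_le_mass τ b).trans_lt hfin⟩
  lift τ.mass to ℝ≥0 using hfin.ne with M hM
  have hM0 : M ≠ 0 := by simpa using hne
  have h1 := h (τ.scale M⁻¹) ((mem_tracialStates_iff hσ).2 (by
    rw [τ.mass_scale, ← hM, ← ENNReal.coe_mul, inv_mul_cancel₀ hM0, ENNReal.coe_one]))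
  rw [dim_scale, dim_scale] at h1
  exact lt_of_mul_lt_mul_left' h1

/-! ### From compactness to continuous scale, and the equivalences -/

lemma hasContinuousScale_of_isCompact [IsSimpleRing A] [Nontrivial A] (hσ : IsSigmaUnital A)
    (hsc : HasStrictComparison A) (hc : IsCompact (tracialStates A)) : HasContinuousScale A := by
  obtain ⟨a, ha⟩ := id hσ
  have he := ha.isNestedApproxUnit
  set e : ℕ → A := fun n => cfcₙ (cutoff (dyadic n)) a
  have hcont {b : A} (hb : 0 ≤ b) : Continuous fun τ : LscTrace A => τ b :=
    continuous_apply hb (ped_eq_univ (A := A) ▸ mem_univ b)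
  refine ⟨e, he, fun b hb hb0 => ?_⟩
  have hn0 : 0 < ‖b‖ := norm_pos_iff.2 hb0
  -- Norm one ensures both `τ(b₁) ≤ 1` on tracial states and `τ(b₁) ≤ d_τ(b₁)`.
  let b₁ : A := ‖b‖⁻¹ • b
  have hb₁ : 0 ≤ b₁ := smul_nonneg (by positivity) hb
  have hb₁1 : ‖b₁‖ = 1 := by rw [norm_smul, norm_inv, norm_norm, inv_mul_cancel₀ hn0.ne']
  have hcov : tracialStates A ⊆ ⋃ n, {τ : LscTrace A | 1 < τ (e n) + τ b₁} := by
    intro τ hτ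
    have hm := (mem_tracialStates_iff hσ).1 hτ
    have hpos : 0 < τ b₁ := by
      refine pos_iff_ne_zero.2 (τ.ne_zero_of_isSimpleRing ?_ hb₁ (norm_ne_zero_iff.1 (by simp [hb₁1])))
      by_contra! h0
      simp [LscTrace.mass, h0] at hm
    have hlt : 1 - τ b₁ < τ.mass := by
      rw [hm]
      exact ENNReal.sub_lt_self ENNReal.one_ne_top one_ne_zero hpos.ne'
    rw [he.mass_eq] at hlt
    obtain ⟨n, hn⟩ := lt_iSup_iff.1 hlt
    refine mem_iUnion.2 ⟨n, ?_⟩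
    have hfin := (τ.lt_top_of_isSimpleRing hb₁).ne
    exact (ENNReal.sub_lt_iff_lt_right hfin (by rw [← hm]; exact τ.le_mass hb₁ hb₁1.le)).1 hn
  obtain ⟨n, hn⟩ := hc.elim_directed_cover _
    (fun n => isOpen_lt continuous_const ((hcont (he.nonneg n)).add (hcont hb₁))) hcov
    (Monotone.directed_le fun i j hij τ (hτ : 1 < _) =>
      hτ.trans_le (add_le_add_left (τ.mono (he.nonneg i) (he.mono hij)) _))
  -- The shift by one lets the tail start at `k + 1` while `τ(e_k) ≥ τ(e_n)` is still available.
  refine ⟨n + 1, fun m k hk hkm => ?_⟩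
  obtain ⟨k, rfl⟩ : ∃ j, k = j + 1 := ⟨k - 1, by omega⟩
  have key : CuntzLE (e m - e (k + 1)) b₁ := by
    refine cuntzLE_of_dim_lt hσ hsc (sub_nonneg.2 (he.mono hkm.le)) hb₁
      (norm_ne_zero_iff.1 (by simp [hb₁1])) fun τ hτ => ?_
    have hm := (mem_tracialStates_iff hσ).1 hτ
    have h1 : 1 < τ (e n) + τ b₁ := hn hτ
    have h2 : dim τ (e m - e (k + 1)) + τ (e n) ≤ 1 := by
      calc _ ≤ dim τ (e m - e (k + 1)) + τ (e k) := by
            gcongr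
            exact τ.mono (he.nonneg n) (he.mono (by omega))
        _ ≤ τ (e (m + 1)) := he.dim_sub_add_le τ hkm
        _ ≤ 1 := hm ▸ τ.le_mass (he.nonneg _) (he.norm_le _)
    have h3 : τ b₁ ≤ dim τ b₁ := by
      simpa [hb₁1] using (cuntzLE_refl hb₁).le_dim hb₁ hb₁ τ
    have h5 := h2.trans_lt h1
    rw [add_comm] at h5
    exact (lt_of_add_lt_add_left h5).trans_le h3
  obtain ⟨x, hx⟩ := key
  -- The square root absorbs the normalizing factor, turning witnesses for `b₁` into witnesses for
  -- `b`.
  refine ⟨fun n => √(‖b‖⁻¹) • x n, hx.congr fun n => ?_⟩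
  simp only [b₁]
  rw [star_smul, star_trivial √(‖b‖⁻¹), smul_mul_assoc, smul_mul_smul_comm,
    Real.mul_self_sqrt (by positivity), mul_smul_comm, smul_mul_assoc]

end ConScale

end

theorem mainTheorem9 {A : Type*} [NonUnitalCStarAlgebra A] [PartialOrder A] [StarOrderedRing A]
    (hσ : ConScale.IsSigmaUnital A) (hsimple : ConScale.IsSimpleCStar A)
    (hel : ¬ ConScale.IsElementary A) :
    (ConScale.HasContinuousScale A →
      IsCompact (ConScale.tracialStates A) ∧
      (∀ a : A, ConScale.IsStrictlyPos a →
        Continuous fun τ : ConScale.LscTrace A => ConScale.dim τ a) ∧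
      (∀ a : A, ConScale.IsStrictlyPos a →
        ContinuousOn (fun τ : ConScale.LscTrace A => ConScale.dim τ a)
          (closure (ConScale.tracialStates A)))) ∧
    (ConScale.HasStrictComparison A → IsSimpleRing A →
      List.TFAE [
        IsCompact (ConScale.tracialStates A),
        ∀ a : A, ConScale.IsStrictlyPos a →
          Continuous fun τ : ConScale.LscTrace A => ConScale.dim τ a,
        ∀ a : A, ConScale.IsStrictlyPos a →
          ContinuousOn (fun τ : ConScale.LscTrace A => ConScale.dim τ a)
            (closure (ConScale.tracialStates A)),
        ConScale.HasContinuousScale A,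
        ∃ a : A, ConScale.IsStrictlyPos a ∧
          ContinuousOn (fun τ : ConScale.LscTrace A => ConScale.dim τ a)
            (closure (ConScale.tracialStates A)),
        ∃ a : A, ConScale.IsStrictlyPos a ∧
          Continuous fun τ : ConScale.LscTrace A => ConScale.dim τ a]) := by
  have hcont (h : ConScale.HasContinuousScale A) (a : A) (ha : ConScale.IsStrictlyPos a) :
      Continuous fun τ : ConScale.LscTrace A => ConScale.dim τ a := by
    simpa only [ha.dim_eq_mass] using h.continuous_mass
  refine ⟨fun h => ⟨ConScale.isCompact_tracialStates_of_continuousOn hσ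
    h.continuous_mass.continuousOn, hcont h, fun a ha => (hcont h a ha).continuousOn⟩, ?_⟩
  intro hsc hring
  have := hsimple.1
  tfae_have 1 → 4 := ConScale.hasContinuousScale_of_isCompact hσ hsc
  tfae_have 4 → 2 := hcont
  tfae_have 2 → 3 := fun h a ha => (h a ha).continuousOn
  -- σ-unitality supplies the strictly positive element.
  tfae_have 2 → 6 := fun h => hσ.imp fun a ha => ⟨ha, h a ha⟩
  tfae_have 3 → 5 := fun h => hσ.imp fun a ha => ⟨ha, h a ha⟩
  tfae_have 6 → 5 := fun ⟨a, ha, h⟩ => ⟨a, ha, h.continuousOn⟩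
  tfae_have 5 → 1 := fun ⟨a, ha, h⟩ =>
    ConScale.isCompact_tracialStates_of_continuousOn hσ (by simpa only [ha.dim_eq_mass] using h)
  tfae_finish
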